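/- **The computation.** Let $n,d,g\ge 0$ be integers and $r=\binom{d+g}{g}$. Approximate attention takes $Q,K,V\in\mathbb R^{n\times d}$ and computes $\widetilde D^{-1}\bigl(U_1(U_2^{\top}V)\bigr)$ with $\widetilde D=\mathrm{diag}\bigl(U_1(U_2^{\top}\mathbf 1)\bigr)$, where $U_1,U_2\in\mathbb R^{n\times r}$ have one column for each monomial of total degree at most $g$ in $d$ variables, and row $i$ of $U_1$ (of $U_2$) consists of fixed multiples of the values of these monomials at row $i$ of $Q$ (of $K$). Matrix products are computed by the standard inner-product algorithm. The computational DAG has one node for each entry of $Q,K,V$; one node for each entry of $U_1$ (of $U_2$), whose parents are the entries of $Q$ (of $K$) whose variables occur in its monomial; one node for each scalar product $(U_2)_{i,m}V_{i,j}$, $(U_1)_{i,m}(U_2^{\top}V)_{m,j}$ and $(U_1)_{i,m}(U_2^{\top}\mathbf 1)_m$, with its two factors as parents; one node for each entry of $U_2^{\top}V$, $U_2^{\top}\mathbf 1$, $U_1(U_2^{\top}V)$ and for each diagonal entry of $\widetilde D$, whose parents are the summands of the defining sum; and one node for each entry of the result, whose parents are the corresponding entries of $U_1(U_2^{\top}V)$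 and of the diagonal of $\widetilde D$. **The cost.** The I/O cost is measured in the red-blue pebble game with partial computations and with recomputation. There is a fast memory of capacity $M$ and an unlimited slow memory; each of them can hold, for a node, a partial result into which some set of its parents has been aggregated. Initially the slow memory holds the sources of the DAG and the fast memory is empty. A step can load (copy a value from slow to fast memory) or save (copy a value from fast to slow memory), each at cost $1$; or, at no cost, delete a value from fast memory, or aggregate one not yet aggregated parent $u$ of a node $v$, where the completely computed value of $u$ is in fast memory, into the partial result of $v$ in fast memory (starting a new partial result if there is none there). The fast memory never holds values of more than $M$ nodes. At the end all sinks, completely computed, must be in slow memory. The optimal I/O cost $\mathrm{IO}(n,d,g,M)$ is the least total cost of such a sequence of steps ($\infty$ if there is none). **Theorem.** Let $n,d,g,M$ vary along a family of parameters, let $r=\binom{d+g}{g}$, and assume that eventually $r\le n$ and $M\ge 2$. If $M=o(d\cdot r)$ and $g=\Omega(\sqrt M)$, then $$\mathrm{IO}(n,d,g,M)=O\!\left(\frac{n\cdot r\cdot d}{\sqrt M}\right),$$ and if moreover $d\ge 5g$ eventually, then also $$\mathrm{IO}(n,d,g,M)=\Omega\!\left(\frac{n\cdot r\cdot d}{\sqrt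 M}\right),$$ so that then $\mathrm{IO}(n,d,g,M)=\Theta\!\left(\frac{n\cdot r\cdot d}{\sqrt M}\right)$. -/

import Mathlib

open Filter Asymptotics
open scoped ENNReal

/-! ### The red-blue pebble game with partial computations -/

namespace Pebble

/-- A configuration of the two-level memory, for a computation whose operations are the elements
of `V`. At each of the two levels, `none` means that nothing is stored for the node, and `some S`
means that the partial result of the node is stored into which exactly the parents in `S` have been
aggregated. A red pebble is `fast v ≠ none`, a blue pebble is `slow v ≠ none`. -/
structure Config (V : Type*) where
  /-- the content of the fast memory -/
  fast : V → Option (Set V)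
  /-- the content of the slow memory -/
  slow : V → Option (Set V)

/-- The parents (direct predecessors) of a node; `E u v` says that there is an edge from `u`
to `v`. -/
def parents {V : Type*} (E : V → V → Prop) (v : V) : Set V := {u | E u v}

/-- A source: a node without parents. -/
def IsSource {V : Type*} (E : V → V → Prop) (v : V) : Prop := ∀ u, ¬ E u v

/-- A sink: a node without children. -/
def IsSink {V : Type*} (E : V → V → Prop) (v : V) : Prop := ∀ w, ¬ E v w

open Classical in
/-- Initially the slow memory holds the sources, and the fast memory is empty. -/
noncomputable def initial {V : Type*} (E : V → V → Prop) : Config V where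
  fast := fun _ => none
  slow := fun v => if IsSource E v then some ∅ else none

/-- At the end all sinks, completely computed, are in slow memory. -/
def IsFinal {V : Type*} (E : V → V → Prop) (c : Config V) : Prop :=
  ∀ v, IsSink E v → c.slow v = some (parents E v)

open Classical in
/-- `Step E c c' k`: one step of the game leads from `c` to `c'` and has I/O cost `k`. Loads and
saves cost `1`, computations and deletions are free. A computation step aggregates a parent `u` into
`v`: the value of `u` has to be complete and in fast memory, and it is added to the partial result of
`v` in fast memory, or it starts a new one if there is none. Recomputation is allowed. -/
inductive Step {V : Type*} (E : V → V → Prop) : Config V → Config V → ℕ → Prop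
  | load (c : Config V) (v : V) (S : Set V) (hv : c.slow v = some S) :
      Step E c ⟨Function.update c.fast v (some S), c.slow⟩ 1
  | save (c : Config V) (v : V) (S : Set V) (hv : c.fast v = some S) :
      Step E c ⟨c.fast, Function.update c.slow v (some S)⟩ 1
  | begin (c : Config V) (u v : V) (huv : E u v) (hu : c.fast u = some (parents E u))
      (hv : c.fast v = none) :
      Step E c ⟨Function.update c.fast v (some {u}), c.slow⟩ 0
  | aggregate (c : Config V) (u v : V) (S : Set V) (huv : E u v)
      (hu : c.fast u = some (parents E u)) (hv : c.fast v = some S) (huS : u ∉ S) :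
      Step E c ⟨Function.update c.fast v (some (insert u S)), c.slow⟩ 0
  | delete (c : Config V) (v : V) :
      Step E c ⟨Function.update c.fast v none, c.slow⟩ 0

/-- `Reach E M c k`: a sequence of steps of total I/O cost `k` leads from the initial configuration
to `c`, with never more than `M` values in fast memory. -/
inductive Reach {V : Type*} (E : V → V → Prop) (M : ℕ) : Config V → ℕ → Prop
  | start : Reach E M (initial E) 0
  | step {c c' : Config V} {k j : ℕ} (hc : Reach E M c k) (hs : Step E c c' j)
      (hM : {v | c'.fast v ≠ none}.encard ≤ M) : Reach E M c' (k + j)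

/-- The optimal I/O cost of the computation with edge relation `E` and fast memory of capacity `M`:
the least total cost of a complete pebbling sequence, and `⊤` if there is none. -/
noncomputable def optimalCost {V : Type*} (E : V → V → Prop) (M : ℕ) : ℕ∞ :=
  sInf {q : ℕ∞ | ∃ (c : Config V) (k : ℕ), Reach E M c k ∧ IsFinal E c ∧ q = k}

end Pebble

/-! ### The computational DAG of approximate attention -/

namespace ApproxAttention

/-- The monomials of total degree at most `g` in `d` variables, as vectors of exponents. There are
`(d + g).choose g` of them; they index the columns of `U₁` and `U₂`. -/
def Monomial (d g : ℕ) : Type := {e : Fin d → Fin (g + 1) // ∑ l, (e l : ℕ) ≤ g}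

/-- The values of the computation of `D⁻¹ (U₁ (U₂ᵀ V))` with `D = diag (U₁ (U₂ᵀ 1))`. The column
index `some j` stands for column `j` of `V`, and `none` for the all-ones column `1`. -/
inductive Node (n d g : ℕ) : Type
  /-- an entry of `Q` -/
  | q (i : Fin n) (l : Fin d)
  /-- an entry of `K` -/
  | k (i : Fin n) (l : Fin d)
  /-- an entry of `V` -/
  | v (i : Fin n) (j : Fin d)
  /-- an entry of `U₁`: a fixed multiple of the monomial `m` in row `i` of `Q` -/
  | u₁ (i : Fin n) (m : Monomial d g)
  /-- an entry of `U₂`: a fixed multiple of the monomial `m` in row `i` of `K` -/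
  | u₂ (i : Fin n) (m : Monomial d g)
  /-- the product of the entry `(i, m)` of `U₂` and the entry `(i, j)` of `V` -/
  | mulH (m : Monomial d g) (i : Fin n) (j : Fin d)
  /-- an entry of `H = U₂ᵀ V` (for `some j`) or of `U₂ᵀ 1` (for `none`) -/
  | h (m : Monomial d g) (j : Option (Fin d))
  /-- the product of the entry `(i, m)` of `U₁` and the entry `(m, j)` of `H` or `U₂ᵀ 1` -/
  | mulO (i : Fin n) (m : Monomial d g) (j : Option (Fin d))
  /-- an entry of `U₁ H` (for `some j`) or the `i`-th diagonal entry of `D` (for `none`) -/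
  | o (i : Fin n) (j : Option (Fin d))
  /-- an entry of the result `D⁻¹ (U₁ H)` -/
  | a (i : Fin n) (j : Fin d)

/-- The data dependencies: `Edge u v` says that the value `u` is an argument of the operation that
computes `v`. All sums and monomials are single nodes. An entry of `U₁` or `U₂` depends exactly on
the variables that occur in its monomial; those of the constant monomial are sources. -/
inductive Edge {n d g : ℕ} : Node n d g → Node n d g → Prop
  | q_u₁ (i : Fin n) (l : Fin d) (m : Monomial d g) (hl : m.1 l ≠ 0) : Edge (.q i l) (.u₁ i m)
  | k_u₂ (i : Fin n) (l : Fin d) (m : Monomial d g) (hl : m.1 l ≠ 0) : Edge (.k i l) (.u₂ i m)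
  | u₂_mulH (m : Monomial d g) (i : Fin n) (j : Fin d) : Edge (.u₂ i m) (.mulH m i j)
  | v_mulH (m : Monomial d g) (i : Fin n) (j : Fin d) : Edge (.v i j) (.mulH m i j)
  | mulH_h (m : Monomial d g) (i : Fin n) (j : Fin d) : Edge (.mulH m i j) (.h m (some j))
  | u₂_h (m : Monomial d g) (i : Fin n) : Edge (.u₂ i m) (.h m none)
  | u₁_mulO (i : Fin n) (m : Monomial d g) (j : Option (Fin d)) : Edge (.u₁ i m) (.mulO i m j)
  | h_mulO (i : Fin n) (m : Monomial d g) (j : Option (Fin d)) : Edge (.h m j) (.mulO i m j)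
  | mulO_o (i : Fin n) (m : Monomial d g) (j : Option (Fin d)) : Edge (.mulO i m j) (.o i j)
  | o_a (i : Fin n) (j : Fin d) : Edge (.o i (some j)) (.a i j)
  | d_a (i : Fin n) (j : Fin d) : Edge (.o i none) (.a i j)

/-- The optimal I/O cost of approximate attention with sequence length `n`, feature dimension `d`,
polynomial degree `g` and fast memory of capacity `M`. -/
noncomputable def ioCost (n d g M : ℕ) : ℕ∞ :=
  Pebble.optimalCost (Edge (n := n) (d := d) (g := g)) M

/-- The number `r` of columns of `U₁` and `U₂`. -/
def rank (d g : ℕ) : ℕ := (d + g).choose g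

end ApproxAttention

/-! Lower bound. A pebbling is cut into segments of I/O cost `M`. All values that are complete in
fast memory during a segment are derivable from a set `X` of at most `2M` values: those in fast
memory at its start and those loaded in it. Partial results survive the segment in at most `2M`
nodes: those saved in it and those in fast memory at its end. Because of recomputation, aggregations
cannot simply be counted when they happen. Instead, `W` collects the aggregations into selected
nodes that survive their segment, and `Justified` says that a completed selected node received every
parent either through `W` or within a single segment, where the parent is derivable from `X`. This
is `Reach.exists_recorded`.

The selected nodes are the entries of `U₂ᵀ V` whose monomial has at least `s` variables. By
`encard_processable_le`, a segment contributes `O(M + M s + M² / s)` edges to `W`: in a row of `K`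
with few given values, entries of `U₂` for such monomials must be given themselves, and there are
few other rows. For `s` of order `√M` this is `O(M^(3/2))`. The assumption `g = Ω(√M)` allows such
an `s` with `4 s ≤ g + 3`, and then at least half of all monomials qualify
(`rank_le_two_mul_wideCard`). Each selected entry has at least `n - 2M` of its `n` summands in `W`,
and `4M ≤ r ≤ n` eventually (`four_mul_le_rank`), so order `n r d / M^(3/2)` segments are needed.

Upper bound. Let `a` be about `√M / 2`. A tile of `U₂ᵀ [V, 1]` is accumulated in fast memory while
the rows of `U₂` and `V` pass by, is used at once for its contribution to all outputs, and is then
discarded (`run_blocks`). If `a ≤ d`, tiles are at most `a × a` and `U₁`, `U₂` are computed once and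
stored. If `d < a`, a tile takes all `d + 1` columns, and blocks of `U₁`, `U₂` are recomputed for
each tile from the rows of `Q` and `K`. -/

namespace Pebble

/-! ### Lower bound: segments of a pebbling with recomputation -/

variable {V : Type*} {E : V → V → Prop}

/-- The nodes that can be computed completely when the values of the nodes in `X` are given. -/
inductive Derivable (E : V → V → Prop) (X : Set V) : V → Prop
  | given {v : V} (hv : v ∈ X) : Derivable E X v
  | computed {v : V} (hv : ∃ u, E u v) (h : ∀ u, E u v → Derivable E X u) : Derivable E X v

theorem Derivable.mono {X X' : Set V} (h : X ⊆ X') {v : V} (hv : Derivable E X v) :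
    Derivable E X' v := by
  induction hv with
  | given hv => exact .given (h hv)
  | computed hv _ ih => exact .computed hv ih

/-- All nodes of `H` among `v` and its ancestors have been computed completely, from the
aggregations recorded in `W` and at most `N` further values for each of these nodes. -/
inductive Justified (E : V → V → Prop) (H : Set V) (N : ℕ) (W : Set (V × V)) : V → Prop
  | mk {v : V}
      (hH : v ∈ H → ∃ X : Finset V, X.card ≤ N ∧ ∀ u, E u v → (u, v) ∈ W ∨ Derivable E X u)
      (h : ∀ u, E u v → Justified E H N W u) : Justified E H N W v

theorem Justified.mono {H : Set V} {N : ℕ} {W W' : Set (V × V)} (hW : W ⊆ W') {v : V}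
    (hv : Justified E H N W v) : Justified E H N W' v := by
  induction hv with
  | mk hH _ ih =>
    refine .mk (fun hv => ?_) ih
    obtain ⟨X, hX, h⟩ := hH hv
    exact ⟨X, hX, fun u hu => (h u hu).imp (fun hu => hW hu) id⟩

theorem Justified.parent {H : Set V} {N : ℕ} {W : Set (V × V)} {u v : V}
    (h : Justified E H N W v) (huv : E u v) : Justified E H N W u := by
  cases h with | mk _ h => exact h u huv

/-- The state of a pebbling that is divided into segments of cost `M`: `W` records the aggregations
into nodes of `H` that were preserved at the end of a segment, `X` contains the nodes that were in
fast memory at the beginning of the present segment or were loaded in it, `Y` those that were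
saved in it, and `q` is the cost of the present segment so far. -/
structure SegmentState (E : V → V → Prop) (H : Set V) (M : ℕ) (c : Config V) (q : ℕ)
    (W : Set (V × V)) (X Y : Finset V) : Prop where
  card_X : X.card ≤ M + q
  card_Y : Y.card ≤ q
  justified : ∀ v S u, c.fast v = some S ∨ c.slow v = some S → u ∈ S →
    E u v ∧ Justified E H (2 * M) W u
  derivable : ∀ v S, c.fast v = some S →
    v ∈ X ∨ ((∃ u, E u v) ∧ ∀ u ∈ S, Derivable E (X : Set V) u)
  recorded : ∀ v ∈ H, ∀ S u, c.fast v = some S ∨ c.slow v = some S → u ∈ S →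
    (u, v) ∈ W ∨ Derivable E (X : Set V) u
  recorded_slow : ∀ v ∈ H, v ∉ Y → ∀ S u, c.slow v = some S → u ∈ S → (u, v) ∈ W

namespace SegmentState

variable {H : Set V} {M q : ℕ} {c : Config V} {W : Set (V × V)} {X Y : Finset V}

/-- A value outside `X` was begun in the present segment, so all its parents were aggregated in this
segment from values that were themselves derivable. -/
theorem derivable_of_complete (h : SegmentState E H M c q W X Y) {u : V}
    (hu : c.fast u = some (parents E u)) : Derivable E (X : Set V) u := by
  rcases h.derivable u _ hu with hX | ⟨h1, h2⟩
  · exact .given hX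
  · exact .computed h1 fun w hw => h2 w hw

/-- The present `X` is the witness; `q ≤ M` keeps its size within `2 * M`. -/
theorem justified_of_complete (h : SegmentState E H M c q W X Y) (hq : q ≤ M) {u : V}
    (hu : c.fast u = some (parents E u)) : Justified E H (2 * M) W u := by
  refine .mk (fun hH => ⟨X, by have := h.card_X; omega, fun w hw => ?_⟩) fun w hw => ?_
  · exact h.recorded u hH _ w (.inl hu) hw
  · exact (h.justified u _ w (.inl hu) hw).2

theorem load [DecidableEq V] (h : SegmentState E H M c q W X Y) {v : V} {S : Set V}
    (hv : c.slow v = some S) :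
    SegmentState E H M ⟨Function.update c.fast v (some S), c.slow⟩ (q + 1) W (insert v X) Y := by
  have hsub : (X : Set V) ⊆ (insert v X : Finset V) := by simp
  have key : ∀ w S', Function.update c.fast v (some S) w = some S' →
      c.fast w = some S' ∨ c.slow w = some S' := by
    intro w S' hw
    by_cases e : w = v
    · subst e; simp at hw; subst hw; exact .inr hv
    · rw [Function.update_of_ne e] at hw; exact .inl hw
  refine ⟨?_, h.card_Y.trans (by omega), ?_, ?_, ?_, h.recorded_slow⟩
  · have := Finset.card_insert_le v X; have := h.card_X; omega
  · rintro w S' u (hw | hw) hu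
    · exact h.justified w S' u (key w S' hw) hu
    · exact h.justified w S' u (.inr hw) hu
  · intro w S' hw
    by_cases e : w = v
    · left; simp [e]
    · simp only [Function.update_of_ne e] at hw
      rcases h.derivable w S' hw with h1 | ⟨h1, h2⟩
      · left; simp [h1]
      · exact .inr ⟨h1, fun u hu => (h2 u hu).mono hsub⟩
  · rintro w hwH S' u hw hu
    have : c.fast w = some S' ∨ c.slow w = some S' := by
      rcases hw with hw | hw
      · exact key w S' hw
      · exact .inr hw
    exact (h.recorded w hwH S' u this hu).imp id (·.mono hsub)

/-- The saved content may contain aggregations that are not in `W` yet; putting `v` into `Y` exempts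
it from `recorded_slow` until the segment ends. -/
theorem save [DecidableEq V] (h : SegmentState E H M c q W X Y) {v : V} {S : Set V}
    (hv : c.fast v = some S) :
    SegmentState E H M ⟨c.fast, Function.update c.slow v (some S)⟩ (q + 1) W X (insert v Y) := by
  have key : ∀ w S', c.fast w = some S' ∨ Function.update c.slow v (some S) w = some S' →
      c.fast w = some S' ∨ c.slow w = some S' := by
    rintro w S' (hw | hw)
    · exact .inl hw
    by_cases e : w = v
    · subst e; simp at hw; subst hw; exact .inl hv
    · rw [Function.update_of_ne e] at hw; exact .inr hw
  refine ⟨h.card_X.trans (by omega), ?_, ?_, h.derivable, ?_, ?_⟩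
  · have := Finset.card_insert_le v Y; have := h.card_Y; omega
  · exact fun w S' u hw hu => h.justified w S' u (key w S' hw) hu
  · exact fun w hwH S' u hw hu => h.recorded w hwH S' u (key w S' hw) hu
  · intro w hwH hwY S' u hw hu
    simp only [Finset.mem_insert, not_or] at hwY
    simp only [Function.update_of_ne hwY.1] at hw
    exact h.recorded_slow w hwH hwY.2 S' u hw hu

/-- A computation step into `v`, whose former content is contained in `S`. -/
theorem compute [DecidableEq V] (h : SegmentState E H M c q W X Y) (hq : q ≤ M) {u v : V}
    {S : Set V} (huv : E u v) (hu : c.fast u = some (parents E u))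
    (hv : c.fast v = some S ∨ S = ∅) :
    SegmentState E H M ⟨Function.update c.fast v (some (insert u S)), c.slow⟩ q W X Y := by
  have hS : ∀ w ∈ S, c.fast v = some S := by
    rintro w hw; rcases hv with hv | rfl
    · exact hv
    · exact hw.elim
  refine ⟨h.card_X, h.card_Y, ?_, ?_, ?_, h.recorded_slow⟩
  · rintro w S' x hw hx
    by_cases e : w = v
    · subst e
      rcases hw with hw | hw
      · simp at hw; subst hw
        rcases hx with rfl | hx
        · exact ⟨huv, h.justified_of_complete hq hu⟩
        · exact h.justified w S x (.inl (hS x hx)) hx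
      · exact h.justified w S' x (.inr hw) hx
    · simp only [Function.update_of_ne e] at hw
      exact h.justified w S' x hw hx
  · intro w S' hw
    by_cases e : w = v
    · subst e
      simp at hw; subst hw
      by_cases hwX : w ∈ X
      · exact .inl hwX
      refine .inr ⟨⟨u, huv⟩, ?_⟩
      rintro x (rfl | hx)
      · exact h.derivable_of_complete hu
      · exact ((h.derivable w S (hS x hx)).resolve_left hwX).2 x hx
    · simp only [Function.update_of_ne e] at hw
      exact h.derivable w S' hw
  · rintro w hwH S' x hw hx
    by_cases e : w = v
    · subst e
      rcases hw with hw | hw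
      · simp at hw; subst hw
        rcases hx with rfl | hx
        · exact .inr (h.derivable_of_complete hu)
        · exact h.recorded w hwH S x (.inl (hS x hx)) hx
      · exact h.recorded w hwH S' x (.inr hw) hx
    · simp only [Function.update_of_ne e] at hw
      exact h.recorded w hwH S' x hw hx

theorem delete [DecidableEq V] (h : SegmentState E H M c q W X Y) (v : V) :
    SegmentState E H M ⟨Function.update c.fast v none, c.slow⟩ q W X Y := by
  have key : ∀ w S', Function.update c.fast v none w = some S' → c.fast w = some S' := by
    intro w S' hw
    by_cases e : w = v
    · subst e; simp at hw
    · rwa [Function.update_of_ne e] at hw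
  exact ⟨h.card_X, h.card_Y, fun w S' u hw hu => h.justified w S' u (hw.imp (key w S') id) hu,
    fun w S' hw => h.derivable w S' (key w S' hw),
    fun w hH S' u hw hu => h.recorded w hH S' u (hw.imp (key w S') id) hu, h.recorded_slow⟩

/-- The end of a segment and the beginning of the next one. -/
theorem next (h : SegmentState E H M c q W X Y) {F : Finset V}
    (hF : ∀ v, v ∈ F ↔ c.fast v ≠ none) (hFM : F.card ≤ M) [DecidableEq V] :
    SegmentState E H M c 0
      (W ∪ {p | p.2 ∈ H ∧ p.2 ∈ Y ∪ F ∧ E p.1 p.2 ∧ Derivable E (X : Set V) p.1}) F ∅ := by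
  have key : ∀ v ∈ H, ∀ S u, c.fast v = some S ∨ c.slow v = some S → u ∈ S →
      (u, v) ∈ W ∪ {p | p.2 ∈ H ∧ p.2 ∈ Y ∪ F ∧ E p.1 p.2 ∧ Derivable E (X : Set V) p.1} := by
    intro v hv S u hS hu
    -- A node outside `Y ∪ F` has only an old copy in slow memory, whose aggregations are already in
    -- `W`.
    by_cases hY : v ∈ Y ∪ F
    · rcases h.recorded v hv S u hS hu with h1 | h1
      · exact .inl h1
      · exact .inr ⟨hv, hY, (h.justified v S u hS hu).1, h1⟩
    · simp only [Finset.mem_union, not_or, hF, not_not] at hY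
      rw [hY.2] at hS
      exact .inl (h.recorded_slow v hv hY.1 S u (hS.resolve_left (by simp)) hu)
  refine ⟨by omega, by simp, ?_, ?_, ?_, ?_⟩
  · intro v S u hS hu
    exact (h.justified v S u hS hu).imp id (·.mono Set.subset_union_left)
  · exact fun v S hv => .inl ((hF v).2 (by simp [hv]))
  · exact fun v hv S u hS hu => .inl (key v hv S u hS hu)
  · exact fun v hv _ S u hS hu => key v hv S u (.inr hS) hu

end SegmentState

theorem Reach.encard_fast_le {M : ℕ} {c : Config V} {k : ℕ} (h : Reach E M c k) :
    {v | c.fast v ≠ none}.encard ≤ M := by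
  cases h with
  | start => simp [initial]
  | step _ _ hM => exact hM

open Classical in
-- A step costs at most `1`, so a segment can be closed when its cost is exactly `M`. Only closing a
-- segment enlarges `W`, each time by at most `B` edges.
theorem Reach.exists_segmentState {H : Set V} {M B : ℕ} (hM : 0 < M)
    (hB : ∀ X Y : Finset V, X.card ≤ 2 * M → Y.card ≤ 2 * M →
      {p : V × V | p.2 ∈ H ∧ p.2 ∈ Y ∧ E p.1 p.2 ∧ Derivable E (X : Set V) p.1}.encard ≤ B)
    {c : Config V} {k : ℕ} (h : Reach E M c k) :
    ∃ s q W X Y, k = s * M + q ∧ q < M ∧ W.encard ≤ ((s * B : ℕ) : ℕ∞) ∧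
      SegmentState E H M c q W X Y := by
  induction h with
  | start =>
    refine ⟨0, 0, ∅, ∅, ∅, by simp, hM, by simp, ⟨by simp, by simp, ?_, ?_, ?_, ?_⟩⟩ <;>
    · simp +contextual [initial]
      try grind
  | @step c c' k j hc hs hcap ih =>
    obtain ⟨s, q, W, X, Y, hk, hq, hW, hS⟩ := ih
    have main : ∃ X' Y', SegmentState E H M c' (q + j) W X' Y' ∧ j ≤ 1 := by
      cases hs with
      | load v S hv => exact ⟨_, _, hS.load hv, le_rfl⟩
      | save v S hv => exact ⟨_, _, hS.save hv, le_rfl⟩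
      | begin u v huv hu hv =>
        have := hS.compute hq.le huv hu (S := ∅) (.inr rfl)
        rw [insert_empty_eq] at this
        exact ⟨_, _, this, by omega⟩
      | aggregate u v S huv hu hv huS =>
        exact ⟨_, _, hS.compute hq.le huv hu (.inl hv), by omega⟩
      | delete v => exact ⟨_, _, hS.delete v, by omega⟩
    obtain ⟨X', Y', hS', hj⟩ := main
    by_cases hqM : q + j < M
    · exact ⟨s, q + j, W, X', Y', by omega, hqM, hW, hS'⟩
    have hfin : {v | c'.fast v ≠ none}.Finite :=
      Set.finite_of_encard_le_coe hcap
    have hFM : hfin.toFinset.card ≤ M := by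
      rw [hfin.encard_eq_coe_toFinset_card] at hcap
      exact_mod_cast hcap
    have hn := hS'.next (F := hfin.toFinset) (by simp) hFM
    refine ⟨s + 1, 0, _, _, _, by nlinarith, hM, ?_, hn⟩
    refine (Set.encard_union_le _ _).trans ?_
    rw [add_mul, one_mul, Nat.cast_add]
    -- Both bounds are `M + M`: start and loads for `X'`; saves and end for `Y'` with the final fast
    -- memory.
    refine add_le_add hW (hB X' _ ?_ ?_)
    · have := hS'.card_X; omega
    · have := Finset.card_union_le Y' hfin.toFinset
      have := hS'.card_Y; omega

/-- The partition argument: if with at most `2 * M` given values at most `B` edges into at most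
`2 * M` given nodes of `H` can be processed, then the edges into nodes of `H` other than those which
can be processed with `2 * M` given values cost at least `M` for each `B` of them. -/
theorem Reach.exists_recorded {H : Set V} {M B : ℕ} (hM : 0 < M)
    (hB : ∀ X Y : Finset V, X.card ≤ 2 * M → Y.card ≤ 2 * M →
      {p : V × V | p.2 ∈ H ∧ p.2 ∈ Y ∧ E p.1 p.2 ∧ Derivable E (X : Set V) p.1}.encard ≤ B)
    {c : Config V} {k : ℕ} (h : Reach E M c k) :
    ∃ s W, s * M ≤ k ∧ W.encard ≤ ((s * B : ℕ) : ℕ∞) ∧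
      ∀ v, c.slow v = some (parents E v) → ∀ u, E u v → Justified E H (2 * M) W u := by
  obtain ⟨s, q, W, X, Y, hk, hq, hW, hS⟩ := h.exists_segmentState hM hB
  exact ⟨s, W, by omega, hW, fun v hv u hu => (hS.justified v _ u (.inr hv) hu).2⟩

end Pebble

/-! ### Lower bound: summands of `U₂ᵀ V` that few given values can supply -/

namespace ApproxAttention

open Pebble

variable {n d g : ℕ}

noncomputable instance : Fintype (Monomial d g) := by unfold Monomial; infer_instance

namespace Monomial

/-- The variables that occur in a monomial. -/
def support (m : Monomial d g) : Finset (Fin d) := {l | m.1 l ≠ 0}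

@[simp] theorem mem_support {m : Monomial d g} {l : Fin d} : l ∈ m.support ↔ m.1 l ≠ 0 := by
  simp [support]

end Monomial

section Derivable

variable {X : Set (Node n d g)}

theorem mem_of_derivable_k {i : Fin n} {l : Fin d} (h : Derivable Edge X (.k i l)) :
    .k i l ∈ X := by
  cases h with
  | given h => exact h
  | computed h _ => obtain ⟨u, hu⟩ := h; cases hu

theorem mem_of_derivable_v {i : Fin n} {j : Fin d} (h : Derivable Edge X (.v i j)) :
    .v i j ∈ X := by
  cases h with
  | given h => exact h
  | computed h _ => obtain ⟨u, hu⟩ := h; cases hu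

theorem mem_of_derivable_u₂ {i : Fin n} {m : Monomial d g} (h : Derivable Edge X (.u₂ i m)) :
    .u₂ i m ∈ X ∨ ∀ l ∈ m.support, .k i l ∈ X := by
  cases h with
  | given h => exact .inl h
  | computed _ h =>
    exact .inr fun l hl => mem_of_derivable_k (h _ (.k_u₂ i l m (by simpa using hl)))

theorem mem_of_derivable_mulH {m : Monomial d g} {i : Fin n} {j : Fin d}
    (h : Derivable Edge X (.mulH m i j)) :
    .mulH m i j ∈ X ∨ .v i j ∈ X ∧ (.u₂ i m ∈ X ∨ ∀ l ∈ m.support, .k i l ∈ X) := by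
  cases h with
  | given h => exact .inl h
  | computed _ h =>
    exact .inr ⟨mem_of_derivable_v (h _ (.v_mulH m i j)),
      mem_of_derivable_u₂ (h _ (.u₂_mulH m i j))⟩

end Derivable

/-- The entries of `H` whose monomials contain at least `s` variables. -/
def wideH (n d g s : ℕ) : Set (Node n d g) :=
  {x | ∃ m : Monomial d g, ∃ j, s ≤ m.support.card ∧ x = .h m (some j)}

/-- The row of `K` on which an entry of `K` or `U₂` depends. -/
def keyRow : Node n d g → Option (Fin n)
  | .k i _ => some i
  | .u₂ i _ => some i
  | _ => none

open Classical in
-- A node belongs to at most one row, so the parts of `X` in different rows are disjoint.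
theorem card_heavyRows_mul_le (X : Finset (Node n d g)) (s : ℕ) :
    ({i | s ≤ (X.filter (fun x => keyRow x = some i)).card} : Finset (Fin n)).card * s
      ≤ X.card := by
  rw [← smul_eq_mul]
  refine (Finset.card_nsmul_le_sum _ (fun i => (X.filter (fun x => keyRow x = some i)).card) s
    (by simp)).trans ?_
  rw [← Finset.card_biUnion]
  · exact Finset.card_le_card fun x hx => by
      simp only [Finset.mem_biUnion, Finset.mem_filter] at hx
      obtain ⟨_, _, h, _⟩ := hx
      exact h
  · intro i _ i' _ hne
    refine Finset.disjoint_left.2 fun x hx hx' => hne ?_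
    simp only [Finset.mem_filter] at hx hx'
    exact Option.some.inj (hx.2.symm.trans hx'.2)

open Classical in
theorem support_card_le_filter_keyRow {X : Finset (Node n d g)} {i : Fin n} {m : Monomial d g}
    (h : ∀ l ∈ m.support, .k i l ∈ X) :
    m.support.card ≤ (X.filter (fun x => keyRow x = some i)).card := by
  refine Finset.card_le_card_of_injOn (fun l => .k i l) (fun l hl => ?_) (fun l _ l' _ h => ?_)
  · exact Finset.mem_coe.2 (Finset.mem_filter.2 ⟨h l hl, rfl⟩)
  · simpa using h

open Classical in
/-- The number of products that can be added to given entries of `H`. -/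
theorem encard_processable_le {N s : ℕ} (hs : 0 < s) (X Y : Finset (Node n d g))
    (hX : X.card ≤ N) (hY : Y.card ≤ N) :
    {p : Node n d g × Node n d g | p.2 ∈ wideH n d g s ∧ p.2 ∈ Y ∧ Edge p.1 p.2 ∧
      Derivable Edge (X : Set (Node n d g)) p.1}.encard ≤ ((N + N * s + N / s * N : ℕ) : ℕ∞) := by
  let row (i : Fin n) : Finset (Node n d g) := X.filter (fun x => keyRow x = some i)
  -- The product itself is given. The other branch of the `match`, here and below, is a filler.
  let P₁ : Finset (Node n d g × Node n d g) := X.image fun x => match x with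
    | .mulH m _ j => (x, .h m (some j))
    | _ => (x, x)
  -- A given entry of `V` in a light row is paired with a given entry of `U₂` in that row: fewer
  -- than `s` partners each.
  let P₂ : Finset (Node n d g × Node n d g) := X.biUnion fun x => match x with
    | .v i j => if (row i).card < s then (row i).image fun y => match y with
        | .u₂ _ m => (.mulH m i j, .h m (some j))
        | _ => (y, y)
      else ∅
    | _ => ∅
  -- A heavy row and a target in `Y` determine the product; there are at most `N / s` heavy rows.
  let P₃ : Finset (Node n d g × Node n d g) :=
    (({i | s ≤ (row i).card} : Finset (Fin n)) ×ˢ Y).image fun q => match q.2 with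
    | .h m (some j) => (.mulH m q.1 j, q.2)
    | _ => (q.2, q.2)
  have h₁ : P₁.card ≤ N := Finset.card_image_le.trans hX
  have h₂ : P₂.card ≤ N * s := by
    refine (Finset.card_biUnion_le_card_mul _ _ s fun x _ => ?_).trans
      (Nat.mul_le_mul_right _ hX)
    split
    · split_ifs with h
      · exact Finset.card_image_le.trans h.le
      · simp
    · simp
  have h₃ : P₃.card ≤ N / s * N := by
    refine Finset.card_image_le.trans ?_
    rw [Finset.card_product]
    refine Nat.mul_le_mul ?_ hY
    rw [Nat.le_div_iff_mul_le hs]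
    exact (card_heavyRows_mul_le X s).trans hX
  have hsub : {p : Node n d g × Node n d g | p.2 ∈ wideH n d g s ∧ p.2 ∈ Y ∧ Edge p.1 p.2 ∧
      Derivable Edge (X : Set (Node n d g)) p.1} ⊆ (P₁ ∪ P₂ ∪ P₃ : Finset _) := by
    rintro ⟨u, v⟩ ⟨⟨m, j, hm, hv⟩, hvY, hE, hD⟩
    simp only at hv hvY hE hD
    subst hv
    cases hE with | mulH_h _ i _ => ?_
    simp only [Finset.coe_union, Set.mem_union, Finset.mem_coe]
    rcases mem_of_derivable_mulH hD with h | ⟨hv, hu⟩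
    · exact .inl (.inl (Finset.mem_image.2 ⟨_, h, rfl⟩))
    by_cases hrow : s ≤ (row i).card
    · exact .inr (Finset.mem_image.2 ⟨(i, .h m (some j)), by simp [hrow, hvY], rfl⟩)
    refine .inl (.inr (Finset.mem_biUnion.2 ⟨_, hv, ?_⟩))
    simp only [if_pos (not_le.1 hrow)]
    rcases hu with hu | hu
    · exact Finset.mem_image.2 ⟨.u₂ i m, Finset.mem_filter.2 ⟨hu, rfl⟩, rfl⟩
    -- A light row does not contain the `s` entries of `K` needed to compute the entry of `U₂`. Only
    -- here is the number of variables of the monomial used.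
    · exact absurd (hm.trans (support_card_le_filter_keyRow hu)) hrow
  refine (Set.encard_le_encard hsub).trans ?_
  rw [Set.encard_coe_eq_coe_finsetCard]
  have := Finset.card_union_le (P₁ ∪ P₂) P₃
  have := Finset.card_union_le P₁ P₂
  exact_mod_cast (by omega : (P₁ ∪ P₂ ∪ P₃).card ≤ N + N * s + N / s * N)

open Classical in
-- Each row needs a given value of its own: the product itself or the source `v i j`.
theorem card_derivable_rows_le (X : Finset (Node n d g)) (m : Monomial d g) (j : Fin d) :
    ({i | Derivable Edge (X : Set (Node n d g)) (.mulH m i j)} : Finset (Fin n)).card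
      ≤ X.card := by
  refine Finset.card_le_card_of_injOn
    (fun i => if .mulH m i j ∈ X then .mulH m i j else .v i j) (fun i hi => ?_)
    (fun i _ i' _ h => ?_)
  · have hi' := mem_of_derivable_mulH (by simpa using hi)
    simp only [Finset.mem_coe] at hi' ⊢
    split_ifs with h
    · exact h
    · exact (hi'.resolve_left h).1
  · simp only at h
    split_ifs at h <;> simpa using h

open Classical in
-- Of the `n` summands of the completed entry, only those derivable from one set of at most `N`
-- values can be missing from `W`.
theorem card_recorded_rows_ge {N : ℕ} {W : Set (Node n d g × Node n d g)} {s : ℕ}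
    {m : Monomial d g} {j : Fin d} (hm : s ≤ m.support.card)
    (h : Justified Edge (wideH n d g s) N W (.h m (some j))) :
    n - N ≤ ({i | (.mulH m i j, .h m (some j)) ∈ W} : Finset (Fin n)).card := by
  cases h with
  | mk hH _ =>
    obtain ⟨X, hX, h⟩ := hH ⟨m, j, hm, rfl⟩
    have h1 := (card_derivable_rows_le X m j).trans hX
    have h2 : (Finset.univ : Finset (Fin n)) ⊆
        ({i | (.mulH m i j, .h m (some j)) ∈ W} : Finset (Fin n)) ∪
        ({i | Derivable Edge (X : Set (Node n d g)) (.mulH m i j)} : Finset (Fin n)) := by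
      intro i _
      simpa using h _ (.mulH_h m i j)
    have h3 := (Finset.card_le_card h2).trans (Finset.card_union_le _ _)
    rw [Finset.card_univ, Fintype.card_fin] at h3
    omega

/-- The number of monomials with at least `s` variables. -/
noncomputable def wideCard (d g s : ℕ) : ℕ :=
  (Finset.univ.filter fun m : Monomial d g => s ≤ m.support.card).card

open Classical in
-- The set `W` is counted twice: from below over the rows of all selected entries, from above by the
-- number of closed segments, each of which cost `M`.
theorem lower_bound_of_reach {M s k : ℕ} (hM : 0 < M) (hs : 0 < s)
    {c : Config (Node n d g)} (h : Reach Edge M c k) (hc : IsFinal Edge c) :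
    M * (wideCard d g s * d * (n - 2 * M)) ≤
      k * (2 * M + 2 * M * s + 2 * M / s * (2 * M)) := by
  set B := 2 * M + 2 * M * s + 2 * M / s * (2 * M)
  obtain ⟨t, W, ht, hW, hJ⟩ := h.exists_recorded (H := wideH n d g s) hM
    (fun X Y hX hY => encard_processable_le hs X Y hX hY)
  have hWfin : W.Finite := Set.finite_of_encard_le_coe hW
  rw [hWfin.encard_eq_coe_toFinset_card, Nat.cast_le] at hW
  rcases Nat.eq_zero_or_pos n with rfl | hn
  · simp
  have hJh : ∀ (m : Monomial d g) (j : Fin d),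
      Justified Edge (wideH n d g s) (2 * M) W (.h m (some j)) := by
    intro m j
    -- Every entry of `H` is an ancestor of a sink in the first row of the result, so one row
    -- suffices to justify all of them.
    have h1 := hJ (.a ⟨0, hn⟩ j) (hc _ fun w hw => by cases hw) _ (.o_a _ _)
    exact (h1.parent (.mulO_o _ m _)).parent (.h_mulO _ _ _)
  have key : wideCard d g s * d * (n - 2 * M) ≤ hWfin.toFinset.card := by
    let T := (Finset.univ.filter fun m : Monomial d g => s ≤ m.support.card) ×ˢ
      (Finset.univ : Finset (Fin d))
    have hT : T.card = wideCard d g s * d := by simp [T, wideCard]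
    rw [← hT, ← smul_eq_mul]
    let f (p : Monomial d g × Fin d) : Finset (Fin n) :=
      {i | (.mulH p.1 i p.2, .h p.1 (some p.2)) ∈ W}
    refine (Finset.card_nsmul_le_sum T (fun p => (f p).card) _ fun p hp => ?_).trans ?_
    · exact card_recorded_rows_ge (by simpa [T] using hp) (hJh p.1 p.2)
    rw [← Finset.card_sigma]
    refine Finset.card_le_card_of_injOn
      (fun q => (.mulH q.1.1 q.2 q.1.2, .h q.1.1 (some q.1.2))) (fun q hq => ?_) ?_
    · simp only [Finset.coe_sigma, Set.mem_sigma_iff] at hq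
      simpa [f] using hq.2
    · rintro ⟨⟨m, j⟩, i⟩ _ ⟨⟨m', j'⟩, i'⟩ _ h
      simp only [Prod.mk.injEq, Node.mulH.injEq] at h
      obtain ⟨⟨rfl, rfl, rfl⟩, _⟩ := h
      rfl
  calc M * (wideCard d g s * d * (n - 2 * M)) ≤ M * (t * B) :=
        Nat.mul_le_mul_left _ (key.trans hW)
    _ = (t * M) * B := by ring
    _ ≤ k * B := Nat.mul_le_mul_right _ ht

end ApproxAttention

/-! ### Counting monomials by their number of variables -/

namespace ApproxAttention

variable {d g : ℕ}

/-- The vectors of exponents with sum at most `g` and exactly `k` nonzero entries. -/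
def exponents (d g k : ℕ) : Finset (Fin d → ℕ) :=
  (Fintype.piFinset fun _ => Finset.range (g + 1)).filter fun e =>
    ∑ l, e l ≤ g ∧ (Finset.univ.filter fun l => e l ≠ 0).card = k

theorem mem_exponents {k : ℕ} {e : Fin d → ℕ} :
    e ∈ exponents d g k ↔ ∑ l, e l ≤ g ∧ (Finset.univ.filter fun l => e l ≠ 0).card = k := by
  simp only [exponents, Finset.mem_filter, Fintype.mem_piFinset, Finset.mem_range, and_iff_right_iff_imp]
  intro h l
  have := Finset.single_le_sum (f := e) (fun _ _ => Nat.zero_le _) (Finset.mem_univ l)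
  omega

theorem sum_range_choose_eq (g k : ℕ) : ∑ i ∈ Finset.range g, i.choose k = g.choose (k + 1) := by
  induction g with
  | zero => simp
  | succ g ih => rw [Finset.sum_range_succ, ih, Nat.choose_succ_succ, add_comm]

theorem card_support_cons (a : ℕ) (e : Fin d → ℕ) :
    (Finset.univ.filter fun l => (Fin.cons a e : Fin (d + 1) → ℕ) l ≠ 0).card =
      (if a = 0 then 0 else 1) + (Finset.univ.filter fun l => e l ≠ 0).card := by
  simp only [Finset.card_filter, Fin.sum_univ_succ, Fin.cons_zero, Fin.cons_succ]
  split_ifs <;> simp_all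

/-- Removing the first exponent `a` lowers the degree bound by `a`, and uses up one nonzero entry
exactly if `a ≠ 0`. -/
theorem card_filter_exponents {k a : ℕ} (ha : a ≤ g) :
    ((exponents (d + 1) g (k + 1)).filter fun e => e 0 = a).card =
      (exponents d (g - a) (if a = 0 then k + 1 else k)).card := by
  refine Finset.card_nbij' Fin.tail (fun e => Fin.cons a e) ?_ ?_ ?_ ?_
  · intro e he
    simp only [Finset.coe_filter, Set.mem_ofPred_eq, mem_exponents] at he
    obtain ⟨⟨h1, h2⟩, h3⟩ := he
    rw [← Fin.cons_self_tail e, card_support_cons, h3] at h2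
    rw [Fin.sum_univ_succ] at h1
    simp only [Finset.mem_coe, mem_exponents, Fin.tail] at h2 ⊢
    split_ifs at h2 ⊢ <;> omega
  · intro e he
    simp only [Finset.mem_coe, mem_exponents] at he
    have h1 : ∑ l, (Fin.cons a e : Fin (d + 1) → ℕ) l ≤ g := by
      rw [Fin.sum_univ_succ]
      simp only [Fin.cons_zero, Fin.cons_succ]
      omega
    simp only [Finset.coe_filter, Set.mem_ofPred_eq, mem_exponents]
    rw [card_support_cons, he.2]
    refine ⟨⟨h1, ?_⟩, rfl⟩
    split_ifs <;> omega
  · intro e he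
    simp only [Finset.coe_filter, Set.mem_ofPred_eq] at he
    rw [← he.2]
    exact Fin.cons_self_tail e
  · intro e _
    simp

/-- There are `d.choose k` supports, and the partial sums of the `k` positive exponents form a
`k`-subset of `{1, …, g}`. The formal proof is an induction on `d` by the first exponent: the
positive values are summed by the hockey-stick identity, and Pascal's rule joins them with the value
`0`. -/
theorem card_exponents (d g k : ℕ) : (exponents d g k).card = d.choose k * g.choose k := by
  induction d generalizing g k with
  | zero =>
    cases k with
    | zero =>
      have : exponents 0 g 0 = {0} := by
        ext e
        simp [mem_exponents, eq_iff_true_of_subsingleton]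
      simp [this]
    | succ k =>
      have : exponents 0 g (k + 1) = ∅ := by
        ext e
        simp [mem_exponents]
      simp [this]
  | succ d ih =>
    cases k with
    | zero =>
      have : exponents (d + 1) g 0 = {0} := by
        ext e
        simp only [mem_exponents, Finset.card_eq_zero, Finset.filter_eq_empty_iff,
          Finset.mem_univ, true_implies, not_not, Finset.mem_singleton]
        refine ⟨fun h => funext fun l => @h.2 l, ?_⟩
        rintro rfl
        simp
      simp [this]
    | succ k =>
      rw [Finset.card_eq_sum_card_fiberwise (f := fun e => e 0) (t := Finset.range (g + 1))]
      · rw [Finset.sum_range_succ']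
        have h1 : ∀ a ∈ Finset.range g,
            ((exponents (d + 1) g (k + 1)).filter fun e => e 0 = a + 1).card =
              d.choose k * (g - 1 - a).choose k := by
          intro a ha
          rw [card_filter_exponents (by simpa using ha), ih, if_neg (by omega),
            Nat.sub_sub, Nat.add_comm 1 a]
        rw [Finset.sum_congr rfl h1, card_filter_exponents (Nat.zero_le _), ih, if_pos rfl,
          ← Finset.mul_sum, Finset.sum_range_reflect (fun i => i.choose k) g, sum_range_choose_eq,
          Nat.choose_succ_succ d k, Nat.sub_zero]
        ring
      · intro e he
        simp only [Finset.mem_coe, mem_exponents] at he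
        have := Finset.single_le_sum (f := e) (fun _ _ => Nat.zero_le _) (Finset.mem_univ 0)
        simp only [Finset.coe_range, Set.mem_Iio]
        omega

theorem Monomial.card_support_eq (k : ℕ) :
    (Finset.univ.filter fun m : Monomial d g => m.support.card = k).card =
      d.choose k * g.choose k := by
  rw [← card_exponents]
  refine Finset.card_nbij (fun m l => (m.1 l : ℕ)) ?_ ?_ ?_
  · intro m hm
    simp only [Finset.mem_coe, mem_exponents]
    refine ⟨m.2, ?_⟩
    simp only [Finset.coe_filter, Set.mem_ofPred_eq, Finset.mem_univ, true_and] at hm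
    rw [← hm]
    exact congrArg Finset.card (Finset.ext fun l => by
      rw [m.mem_support, Finset.mem_filter, ← Fin.val_ne_zero_iff]; simp)
  · intro m _ m' _ h
    exact Subtype.ext (funext fun l => Fin.ext (congrFun h l))
  · intro e he
    simp only [Finset.mem_coe, mem_exponents] at he
    have hlt : ∀ l, e l < g + 1 := fun l => by
      have := Finset.single_le_sum (f := e) (fun _ _ => Nat.zero_le _) (Finset.mem_univ l)
      omega
    obtain ⟨m, hm⟩ : ∃ m : Monomial d g, (fun l => (m.1 l : ℕ)) = e :=
      ⟨⟨fun l => ⟨e l, hlt l⟩, he.1⟩, rfl⟩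
    refine ⟨m, ?_, hm⟩
    rw [← hm] at he
    simp only [Finset.coe_filter, Set.mem_ofPred_eq, Finset.mem_univ, true_and]
    rw [← he.2]
    exact congrArg Finset.card (Finset.ext fun l => by
      rw [m.mem_support, Finset.mem_filter, ← Fin.val_ne_zero_iff]; simp)

theorem Monomial.card_support_le (m : Monomial d g) : m.support.card ≤ g := by
  refine le_trans ?_ m.2
  rw [Finset.card_eq_sum_ones, support, Finset.sum_filter]
  refine Finset.sum_le_sum fun l _ => ?_
  split_ifs with h
  · exact Nat.one_le_iff_ne_zero.2 fun h' => h (Fin.ext h')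
  · simp

theorem wideCard_eq_sum (d g s : ℕ) :
    wideCard d g s = ∑ k ∈ Finset.Ico s (g + 1), d.choose k * g.choose k := by
  rw [wideCard, Finset.card_eq_sum_card_fiberwise (f := fun m => m.support.card)
    (t := Finset.Ico s (g + 1))]
  · refine Finset.sum_congr rfl fun k hk => ?_
    rw [← Monomial.card_support_eq, Finset.filter_filter]
    congr 1
    ext m
    simp only [Finset.mem_Ico] at hk
    simp only [Finset.mem_filter, Finset.mem_univ, true_and, and_iff_right_iff_imp]
    omega
  · intro m hm
    have := m.card_support_le
    simp at hm ⊢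
    omega

theorem rank_eq_sum (d g : ℕ) :
    rank d g = ∑ k ∈ Finset.range (g + 1), d.choose k * g.choose k := by
  rw [rank, Nat.add_choose_eq, Finset.Nat.sum_antidiagonal_eq_sum_range_succ_mk]
  refine Finset.sum_congr rfl fun k hk => ?_
  rw [Nat.choose_symm (by simpa [Nat.lt_succ_iff] using hk)]

theorem card_monomial (d g : ℕ) : Fintype.card (Monomial d g) = rank d g := by
  rw [rank_eq_sum, Finset.range_eq_Ico, ← wideCard_eq_sum]
  simp [wideCard]

theorem choose_le_choose_succ {N k : ℕ} (h : 2 * k + 1 ≤ N) : N.choose k ≤ N.choose (k + 1) := by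
  refine Nat.le_of_mul_le_mul_right (c := k + 1) ?_ k.succ_pos
  rw [Nat.choose_succ_right_eq]
  exact Nat.mul_le_mul_left _ (by omega)

theorem choose_le_choose_add {N k a : ℕ} (h : 2 * (k + a) ≤ N + 1) :
    N.choose k ≤ N.choose (k + a) := by
  induction a with
  | zero => rfl
  | succ a ih => exact (ih (by omega)).trans (choose_le_choose_succ (by omega))

/-- The shift `k ↦ k + s` sends each term with `k < s` to a term that is at least as large: both
binomials are still in their increasing range, since `2 * (k + s) ≤ 4 * s - 2 ≤ g + 1 ≤ d + 1`. -/
theorem rank_le_two_mul_wideCard {s : ℕ} (hs : 0 < s) (hsg : 4 * s ≤ g + 3) (hgd : g ≤ d) :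
    rank d g ≤ 2 * wideCard d g s := by
  rw [rank_eq_sum, wideCard_eq_sum, Finset.range_eq_Ico,
    ← Finset.sum_Ico_consecutive _ (Nat.zero_le s) (by omega : s ≤ g + 1), two_mul]
  refine Nat.add_le_add_right ?_ _
  rw [← Finset.range_eq_Ico]
  calc ∑ k ∈ Finset.range s, d.choose k * g.choose k
      ≤ ∑ k ∈ Finset.range s, d.choose (k + s) * g.choose (k + s) := by
        refine Finset.sum_le_sum fun k hk => ?_
        have := Finset.mem_range.1 hk
        exact Nat.mul_le_mul (choose_le_choose_add (by omega)) (choose_le_choose_add (by omega))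
    _ = ∑ k ∈ Finset.Ico s (2 * s), d.choose k * g.choose k := by
        rw [Finset.sum_Ico_eq_sum_range]
        have : 2 * s - s = s := by omega
        rw [this]
        exact Finset.sum_congr rfl fun k _ => by rw [add_comm]
    _ ≤ _ := Finset.sum_le_sum_of_subset (Finset.Ico_subset_Ico le_rfl (by omega))

end ApproxAttention

/-! ### Upper bound: a calculus of pebbling strategies -/

namespace Pebble

variable {V : Type*} {E : V → V → Prop} {M : ℕ}

/-- `Run E M c c' k`: the configuration `c'` can be reached from `c` at cost at most `k`. -/
def Run (E : V → V → Prop) (M : ℕ) (c c' : Config V) (k : ℕ) : Prop :=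
  ∀ j, Reach E M c j → ∃ j' ≤ j + k, Reach E M c' j'

theorem Run.refl (c : Config V) : Run E M c c 0 := fun j h => ⟨j, le_rfl, h⟩

theorem Run.trans {c c' c'' : Config V} {k k' : ℕ} (h : Run E M c c' k) (h' : Run E M c' c'' k') :
    Run E M c c'' (k + k') := by
  intro j hj
  obtain ⟨j₁, h₁, hj₁⟩ := h j hj
  obtain ⟨j₂, h₂, hj₂⟩ := h' j₁ hj₁
  exact ⟨j₂, by omega, hj₂⟩

theorem Run.of_eq {c c' : Config V} (h : c = c') : Run E M c c' 0 := h ▸ Run.refl c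

theorem Run.mono {c c' : Config V} {k k' : ℕ} (h : Run E M c c' k) (hk : k ≤ k') :
    Run E M c c' k' := by
  intro j hj
  obtain ⟨j₁, h₁, hj₁⟩ := h j hj
  exact ⟨j₁, by omega, hj₁⟩

theorem optimalCost_le_of_run {c : Config V} {k : ℕ} (h : Run E M (initial E) c k)
    (hc : IsFinal E c) : optimalCost E M ≤ k := by
  obtain ⟨j, hj, h⟩ := h 0 .start
  have h' : optimalCost E M ≤ j := sInf_le ⟨c, j, h, hc, rfl⟩
  refine h'.trans ?_
  exact_mod_cast (by omega : j ≤ k)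

theorem Config.ext {c c' : Config V} (hf : ∀ v, c.fast v = c'.fast v)
    (hs : ∀ v, c.slow v = c'.slow v) : c = c' := by
  cases c; cases c'
  simp only [Config.mk.injEq]
  exact ⟨funext hf, funext hs⟩

/-- The nodes with a value in fast memory. -/
def Config.dom (c : Config V) : Set V := {v | c.fast v ≠ none}

theorem Config.mem_dom {c : Config V} {v : V} : v ∈ c.dom ↔ c.fast v ≠ none := Iff.rfl

theorem Config.fast_eq_none {c : Config V} {v : V} {D : Set V} (h : c.dom ⊆ D) (hv : v ∉ D) :
    c.fast v = none := by
  by_contra h'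
  exact hv (h h')

theorem Run.of_step {c c' : Config V} {k : ℕ} (h : Step E c c' k) (hM : c'.dom.encard ≤ M) :
    Run E M c c' k := fun j hj => ⟨j + k, le_rfl, hj.step h hM⟩

/-- No value is created, so the capacity bound that every reachable configuration satisfies carries
over. This is why `Run` is relative to `Reach`. -/
theorem Run.of_step_of_dom_subset {c c' : Config V} {k : ℕ} (h : Step E c c' k)
    (hM : c'.dom ⊆ c.dom) : Run E M c c' k :=
  fun j hj => ⟨j + k, le_rfl, hj.step h ((Set.encard_le_encard hM).trans hj.encard_fast_le)⟩

open Classical in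
/-- The content of a memory cell after the aggregation of the parents in `S`. -/
noncomputable def aggregated (o : Option (Set V)) (S : Set V) : Option (Set V) :=
  if S = ∅ then o else some (o.getD ∅ ∪ S)

@[simp] theorem aggregated_empty (o : Option (Set V)) : aggregated o ∅ = o := if_pos rfl

theorem aggregated_of_nonempty (o : Option (Set V)) {S : Set V} (h : S.Nonempty) :
    aggregated o S = some (o.getD ∅ ∪ S) := if_neg h.ne_empty

theorem aggregated_none {S : Set V} (h : S.Nonempty) : aggregated none S = some S := by
  simp [aggregated_of_nonempty _ h]

theorem aggregated_aggregated (o : Option (Set V)) (S S' : Set V) :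
    aggregated (aggregated o S) S' = aggregated o (S ∪ S') := by
  rcases S.eq_empty_or_nonempty with rfl | hS
  · simp
  rcases S'.eq_empty_or_nonempty with rfl | hS'
  · simp
  rw [aggregated_of_nonempty _ hS, aggregated_of_nonempty _ hS',
    aggregated_of_nonempty _ (hS.mono Set.subset_union_left), Option.getD_some, Set.union_assoc]

/-- The tails of the edges in `Z` with head `v`. -/
def tails (Z : Set (V × V)) (v : V) : Set V := {u | (u, v) ∈ Z}

@[simp] theorem mem_tails {Z : Set (V × V)} {u v : V} : u ∈ tails Z v ↔ (u, v) ∈ Z := Iff.rfl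

@[simp] theorem tails_empty (v : V) : tails (∅ : Set (V × V)) v = ∅ := rfl

theorem tails_union (Z Z' : Set (V × V)) (v : V) : tails (Z ∪ Z') v = tails Z v ∪ tails Z' v := rfl

/-- The heads of the edges in `Z` lie in `D`. -/
def HeadsIn (Z : Set (V × V)) (D : Set V) : Prop := ∀ p ∈ Z, p.2 ∈ D

theorem HeadsIn.tails_eq {Z : Set (V × V)} {D : Set V} (h : HeadsIn Z D) {v : V} (hv : v ∉ D) :
    tails Z v = ∅ :=
  Set.eq_empty_of_forall_notMem fun _ hu => hv (h _ hu)

theorem headsIn_empty (D : Set V) : HeadsIn ∅ D := fun _ h => h.elim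

theorem HeadsIn.mono {Z : Set (V × V)} {D D' : Set V} (h : HeadsIn Z D) (hD : D ⊆ D') :
    HeadsIn Z D' := fun p hp => hD (h p hp)

namespace Config

/-- The configuration after the aggregation of the edges in `Z` in fast memory and of those in `Y`
in slow memory. -/
noncomputable def add (c : Config V) (Z Y : Set (V × V)) : Config V where
  fast v := aggregated (c.fast v) (tails Z v)
  slow v := aggregated (c.slow v) (tails Y v)

@[simp] theorem add_empty (c : Config V) : c.add ∅ ∅ = c := by
  apply Config.ext <;> simp [add]

/-- Contents are unions, so the outcome of a strategy depends only on the set of aggregated edges,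
not on order or repetition. Whole algorithms are described by decomposing an edge set. -/
theorem add_add (c : Config V) (Z Y Z' Y' : Set (V × V)) :
    (c.add Z Y).add Z' Y' = c.add (Z ∪ Z') (Y ∪ Y') := by
  apply Config.ext <;> simp [add, aggregated_aggregated, tails_union]

theorem fast_add_of_headsIn (c : Config V) {Z : Set (V × V)} (Y : Set (V × V)) {D : Set V}
    (h : HeadsIn Z D) {v : V} (hv : v ∉ D) : (c.add Z Y).fast v = c.fast v := by
  simp [add, h.tails_eq hv]

theorem slow_add_of_headsIn (c : Config V) (Z : Set (V × V)) {Y : Set (V × V)} {D : Set V}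
    (h : HeadsIn Y D) {v : V} (hv : v ∉ D) : (c.add Z Y).slow v = c.slow v := by
  simp [add, h.tails_eq hv]

@[simp] theorem slow_add_empty (c : Config V) (Z : Set (V × V)) (v : V) :
    (c.add Z ∅).slow v = c.slow v := by
  simp [add]

@[simp] theorem fast_add_empty (c : Config V) (Y : Set (V × V)) (v : V) :
    (c.add ∅ Y).fast v = c.fast v := by
  simp [add]

open Classical in
/-- The configuration with the complete values of the nodes in `T` in fast memory. -/
noncomputable def complete (E : V → V → Prop) (c : Config V) (T : Set V) : Config V where
  fast v := if v ∈ T then some (parents E v) else c.fast v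
  slow := c.slow

open Classical in
/-- The configuration with the contents of the slow memory for the nodes in `T` copied to fast
memory. -/
noncomputable def loaded (c : Config V) (T : Set V) : Config V where
  fast v := if v ∈ T then c.slow v else c.fast v
  slow := c.slow

theorem fast_complete_of_mem (c : Config V) {T : Set V} {v : V} (h : v ∈ T) :
    (c.complete E T).fast v = some (parents E v) := if_pos h

theorem fast_complete_of_notMem (c : Config V) {T : Set V} {v : V} (h : v ∉ T) :
    (c.complete E T).fast v = c.fast v := if_neg h

theorem fast_loaded_of_mem (c : Config V) {T : Set V} {v : V} (h : v ∈ T) :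
    (c.loaded T).fast v = c.slow v := if_pos h

theorem fast_loaded_of_notMem (c : Config V) {T : Set V} {v : V} (h : v ∉ T) :
    (c.loaded T).fast v = c.fast v := if_neg h

theorem dom_complete_subset (c : Config V) (T : Set V) : (c.complete E T).dom ⊆ c.dom ∪ T := by
  intro v hv
  by_cases h : v ∈ T
  · exact .inr h
  · rw [mem_dom, fast_complete_of_notMem _ h] at hv
    exact .inl hv

theorem dom_loaded_subset (c : Config V) (T : Set V) : (c.loaded T).dom ⊆ c.dom ∪ T := by
  intro v hv
  by_cases h : v ∈ T
  · exact .inr h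
  · rw [mem_dom, fast_loaded_of_notMem _ h] at hv
    exact .inl hv

/-- Two configurations differ at most in the contents of the nodes of `D` in fast memory and of
those of `D'` in slow memory. -/
def AgreeOff (c c' : Config V) (D D' : Set V) : Prop :=
  (∀ v, v ∉ D → c'.fast v = c.fast v) ∧ ∀ v, v ∉ D' → c'.slow v = c.slow v

theorem AgreeOff.dom_subset {c c' : Config V} {D D' F : Set V} (h : AgreeOff c c' D D')
    (hc : c.dom ⊆ F) (hD : D ⊆ F) : c'.dom ⊆ F := by
  intro v hv
  by_cases hvD : v ∈ D
  · exact hD hvD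
  · rw [mem_dom, h.1 v hvD] at hv
    exact hc hv

end Config

/-- Aggregating the edges of a union of sets, one set after the other. -/
theorem Run.add_biUnion {α : Type*} (s : Finset α) (Z Y : α → Set (V × V)) {D D' : Set V} {k : ℕ}
    {c : Config V} (hZ : ∀ x ∈ s, HeadsIn (Z x) D) (hY : ∀ x ∈ s, HeadsIn (Y x) D')
    (h : ∀ x ∈ s, ∀ c', c.AgreeOff c' D D' → Run E M c' (c'.add (Z x) (Y x)) k) :
    Run E M c (c.add (⋃ x ∈ s, Z x) (⋃ x ∈ s, Y x)) (s.card * k) := by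
  classical
  induction s using Finset.induction_on with
  | empty => simpa using Run.refl c
  | insert x s hx ih =>
    have ih' := ih (fun y hy => hZ y (Finset.mem_insert_of_mem hy))
      (fun y hy => hY y (Finset.mem_insert_of_mem hy))
      (fun y hy => h y (Finset.mem_insert_of_mem hy))
    have h1 : HeadsIn (⋃ y ∈ s, Z y) D := by
      intro p hp
      simp only [Set.mem_iUnion] at hp
      obtain ⟨y, hy, hp⟩ := hp
      exact hZ y (Finset.mem_insert_of_mem hy) p hp
    have h2 : HeadsIn (⋃ y ∈ s, Y y) D' := by
      intro p hp
      simp only [Set.mem_iUnion] at hp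
      obtain ⟨y, hy, hp⟩ := hp
      exact hY y (Finset.mem_insert_of_mem hy) p hp
    -- The earlier edge sets have changed only cells of `D` and `D'`, so the intermediate
    -- configuration is one of those that `h` covers.
    have hr := ih'.trans (h x (Finset.mem_insert_self x s) _
      ⟨fun v hv => c.fast_add_of_headsIn _ h1 hv, fun v hv => c.slow_add_of_headsIn _ h2 hv⟩)
    rw [Config.add_add] at hr
    rw [Finset.card_insert_of_notMem hx, add_mul, one_mul, Finset.set_biUnion_insert,
      Finset.set_biUnion_insert, Set.union_comm (Z x), Set.union_comm (Y x)]
    exact hr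

theorem Run.add_biUnion_fast {α : Type*} (s : Finset α) (Z : α → Set (V × V)) {D : Set V} {k : ℕ}
    {c : Config V} (hZ : ∀ x ∈ s, HeadsIn (Z x) D)
    (h : ∀ x ∈ s, ∀ c', c.AgreeOff c' D ∅ → Run E M c' (c'.add (Z x) ∅) k) :
    Run E M c (c.add (⋃ x ∈ s, Z x) ∅) (s.card * k) := by
  simpa using Run.add_biUnion s Z (fun _ => ∅) hZ (fun _ _ => headsIn_empty ∅) h

theorem Run.add_biUnion_slow {α : Type*} (s : Finset α) (Y : α → Set (V × V)) {D : Set V} {k : ℕ}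
    {c : Config V} (hY : ∀ x ∈ s, HeadsIn (Y x) D)
    (h : ∀ x ∈ s, ∀ c', c.AgreeOff c' ∅ D → Run E M c' (c'.add ∅ (Y x)) k) :
    Run E M c (c.add ∅ (⋃ x ∈ s, Y x)) (s.card * k) := by
  simpa using Run.add_biUnion s (fun _ => ∅) Y (fun _ _ => headsIn_empty ∅) hY h

open Classical in
/-- Deleting the values of a finite set of nodes. -/
theorem Run.delete (c : Config V) (T : Finset V) :
    Run E M c ⟨fun v => if v ∈ T then none else c.fast v, c.slow⟩ 0 := by
  induction T using Finset.induction_on with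
  | empty => simpa using Run.refl c
  | insert x T hx ih =>
    have h := Run.of_step_of_dom_subset (E := E) (M := M)
      (Step.delete ⟨fun v => if v ∈ T then none else c.fast v, c.slow⟩ x) (by
        intro v hv
        rw [Config.mem_dom] at hv ⊢
        by_cases e : v = x
        · simp [e] at hv
        · simp only [Function.update_of_ne e] at hv
          exact hv)
    convert ih.trans h using 2
    funext v
    by_cases e : v = x
    · simp [e]
    · simp [e]

/-- Loading the values of a finite set of nodes. -/
theorem Run.loaded {c : Config V} (T : Finset V) {k : ℕ} (hT : ∀ v ∈ T, c.fast v = none)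
    (hM : (c.dom ∪ T).encard ≤ M) (hk : {v | v ∈ T ∧ c.slow v ≠ none}.encard ≤ k) :
    Run E M c (c.loaded T) k := by
  classical
  have key : Run E M c (c.loaded T) (T.filter fun v => c.slow v ≠ none).card := by
    clear hk
    induction T using Finset.induction_on with
    | empty =>
      have : c.loaded (∅ : Finset V) = c := by apply Config.ext <;> simp [Config.loaded]
      rw [this]
      exact Run.refl c
    | insert x T hx ih =>
      have ih' := ih (fun v hv => hT v (Finset.mem_insert_of_mem hv))
        ((Set.encard_le_encard (Set.union_subset_union_right _ (by simp))).trans hM)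
      rw [Finset.filter_insert]
      cases hs : c.slow x with
      | none =>
        -- There is nothing to load, and by `hT` the cell in fast memory is empty already, so this
        -- node is free.
        have : c.loaded (insert x T : Finset V) = c.loaded T := by
          apply Config.ext
          · intro v
            by_cases e : v = x
            · subst e
              simp [Config.loaded, hs, hT]
            · simp [Config.loaded, e]
          · simp [Config.loaded]
        rw [this, if_neg (by simp)]
        exact ih'
      | some S =>
        have : c.loaded (insert x T : Finset V) =
            ⟨Function.update (c.loaded T).fast x (some S), (c.loaded T).slow⟩ := by
          apply Config.ext
          · intro v
            by_cases e : v = x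
            · subst e
              simp [Config.loaded, hs]
            · simp [Config.loaded, e]
          · simp [Config.loaded]
        rw [if_pos (by simp), Finset.card_insert_of_notMem (by simp [hx])]
        refine ih'.trans ?_
        rw [this]
        refine Run.of_step (Step.load _ x S hs) ?_
        rw [← this]
        exact (Set.encard_le_encard (c.dom_loaded_subset _)).trans hM
  refine key.mono ?_
  have : {v | v ∈ T ∧ c.slow v ≠ none} = ((T.filter fun v => c.slow v ≠ none : Finset V) : Set V) := by
    ext v; simp
  rw [this, Set.encard_coe_eq_coe_finsetCard] at hk
  exact_mod_cast hk

theorem Run.loaded_card {c : Config V} (T : Finset V) (hT : ∀ v ∈ T, c.fast v = none)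
    (hM : (c.dom ∪ T).encard ≤ M) : Run E M c (c.loaded T) T.card :=
  Run.loaded T hT hM ((Set.encard_le_encard fun _ h => h.1).trans
    (Set.encard_coe_eq_coe_finsetCard T).le)

open Classical in
/-- Saving the values of a finite set of nodes that are in fast memory. -/
theorem Run.save {c : Config V} (T : Finset V) :
    Run E M c ⟨c.fast, fun v => if v ∈ T ∧ c.fast v ≠ none then c.fast v else c.slow v⟩
      T.card := by
  induction T using Finset.induction_on with
  | empty => simpa using Run.refl c
  | insert x T hx ih =>
    rw [Finset.card_insert_of_notMem hx]
    refine ih.trans ?_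
    cases hs : c.fast x with
    | none =>
      refine (Run.of_eq ?_).mono (Nat.zero_le 1)
      apply Config.ext
      · simp
      · intro v
        by_cases e : v = x
        · simp [e, hs]
        · simp [e]
    | some S =>
      convert Run.of_step_of_dom_subset (Step.save
        ⟨c.fast, fun v => if v ∈ T ∧ c.fast v ≠ none then c.fast v else c.slow v⟩ x S hs)
        subset_rfl using 2
      funext v
      by_cases e : v = x
      · subst e; simp [hs]
      · simp [e]

/-- A computation with temporary values of the nodes in `T`, which are deleted at the end. -/
theorem Run.with_complete {c : Config V} (T : Finset V) {Z Y : Set (V × V)} {k k' : ℕ}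
    (hT : ∀ v ∈ T, c.fast v = none) (h : Run E M c (c.complete E T) k)
    (h' : Run E M (c.complete E T) ((c.complete E T).add Z Y) k') {D : Set V} (hZ : HeadsIn Z D)
    (hD : ∀ v ∈ T, v ∉ D) : Run E M c (c.add Z Y) (k + k') := by
  classical
  refine (((h.trans h').trans (Run.delete _ T)).trans (Run.of_eq ?_))
  apply Config.ext
  · intro v
    by_cases hv : v ∈ T
    · simp [Config.add, hv, hT v hv, hZ.tails_eq (hD v hv)]
    · simp [Config.add, hv, Config.complete]
  · simp [Config.add, Config.complete]

/-- Aggregation into values of the slow memory, which are loaded before and saved afterwards. -/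
theorem Run.add_slow {c : Config V} (T : Finset V) {Z : Set (V × V)} {k : ℕ}
    (hT : ∀ v ∈ T, c.fast v = none) (hM : (c.dom ∪ T).encard ≤ M)
    (h : Run E M (c.loaded T) ((c.loaded T).add Z ∅) k) (hZ : HeadsIn Z T) :
    Run E M c (c.add ∅ Z) (2 * T.card + k) := by
  classical
  have h1 := (((Run.loaded_card T hT hM).trans h).trans (Run.save T)).trans (Run.delete _ T)
  refine ((h1.trans (Run.of_eq ?_)).mono (by omega))
  apply Config.ext
  · intro v
    by_cases hv : v ∈ T
    · simp [hv, hT v hv]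
    · simp [Config.add, hv, Config.loaded, hZ.tails_eq (D := T) (v := v) hv]
  · intro v
    by_cases hv : v ∈ T
    · simp only [hv, true_and, Config.add, Config.loaded, Finset.mem_coe, if_true, tails_empty,
        aggregated_empty]
      split_ifs with h
      · rfl
      -- The cell is still empty, so nothing was stored before and nothing was aggregated.
      · rw [not_not] at h
        rcases (tails Z v).eq_empty_or_nonempty with hS | hS
        · simp [hS]
        · simp [aggregated_of_nonempty _ hS] at h
    · simp [Config.add, hv, Config.loaded, hZ.tails_eq (D := T) (v := v) hv]

/-- A single aggregation in fast memory. -/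
theorem Run.aggregate {c : Config V} {u v : V} {D : Set V} (huv : E u v)
    (hu : c.fast u = some (parents E u)) (hc : c.dom ⊆ D) (hv : v ∈ D) (hM : D.encard ≤ M) :
    Run E M c (c.add {(u, v)} ∅) 0 := by
  classical
  have htails : ∀ w, tails {(u, v)} w = if w = v then {u} else ∅ := by
    intro w
    ext x
    split_ifs with h <;> simp [tails, h]
  have hdom : (c.add {(u, v)} ∅).dom ⊆ D := by
    intro w hw
    by_cases e : w = v
    · exact e ▸ hv
    · apply hc
      simpa [Config.mem_dom, Config.add, htails, e] using hw
  have hcap := (Set.encard_le_encard hdom).trans hM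
  have hnew : ∀ S, aggregated (c.fast v) {u} = some S →
      c.add {(u, v)} ∅ = ⟨Function.update c.fast v (some S), c.slow⟩ := by
    intro S hS
    apply Config.ext
    · intro w
      by_cases e : w = v
      · subst e; simp [Config.add, htails, hS]
      · simp [Config.add, htails, e]
    · simp [Config.add]
  cases hS : c.fast v with
  | none =>
    have h := hnew {u} (by simp [aggregated_of_nonempty, hS])
    rw [h] at hcap ⊢
    exact Run.of_step (Step.begin c u v huv hu hS) hcap
  | some S =>
    have h := hnew (insert u S) (by
      simp [aggregated_of_nonempty, hS])
    rw [h] at hcap ⊢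
    -- The game forbids aggregating a parent twice; in that case the content would not change and no
    -- step is made.
    by_cases huS : u ∈ S
    · refine Run.of_eq (Config.ext (fun w => ?_) fun w => rfl)
      by_cases e : w = v
      · subst e; simp [hS, Set.insert_eq_of_mem huS]
      · simp [e]
    · exact Run.of_step (Step.aggregate c u v S huv hu hS huS) hcap

/-- The edges into the nodes of `T`. -/
def edgesInto (E : V → V → Prop) (T : Set V) : Set (V × V) := {p | p.2 ∈ T ∧ E p.1 p.2}

theorem headsIn_edgesInto (T : Set V) : HeadsIn (edgesInto E T) T := fun _ h => h.1

theorem tails_edgesInto {T : Set V} {v : V} (hv : v ∈ T) :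
    tails (edgesInto E T) v = parents E v := by
  ext u
  simp [edgesInto, parents, hv]

/-- The aggregation of all edges into nodes of `T` completes them. -/
theorem Config.add_edgesInto {c : Config V} {T : Set V}
    (hT : ∀ v ∈ T, c.fast v = none ∧ (∃ u, E u v) ∨ c.fast v = some (parents E v)) :
    c.add (edgesInto E T) ∅ = c.complete E T := by
  apply Config.ext
  · intro v
    by_cases hv : v ∈ T
    · rw [fast_complete_of_mem _ hv]
      simp only [add, tails_edgesInto hv]
      -- A node without parents cannot be computed, so it has to be complete beforehand.
      rcases (parents E v).eq_empty_or_nonempty with h0 | h0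
      · rcases hT v hv with ⟨_, u, hu⟩ | h
        · exact absurd (show u ∈ parents E v from hu) (by simp [h0])
        · simp [h0, h]
      · rcases hT v hv with ⟨h, _⟩ | h
        · rw [h, aggregated_none h0]
        · simp [h, aggregated_of_nonempty _ h0]
    · rw [fast_complete_of_notMem _ hv]
      simp [add, (headsIn_edgesInto T).tails_eq hv]
  · simp [complete]

/-- Loading complete values. -/
theorem Config.loaded_eq_complete {c : Config V} {T : Set V}
    (hT : ∀ v ∈ T, c.slow v = some (parents E v)) : c.loaded T = c.complete E T := by
  apply Config.ext
  · intro v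
    by_cases hv : v ∈ T
    · rw [fast_complete_of_mem _ hv, fast_loaded_of_mem _ hv, hT v hv]
    · rw [fast_complete_of_notMem _ hv, fast_loaded_of_notMem _ hv]
  · simp [complete, loaded]

/-- A computation with the temporarily loaded value of the node `u`. -/
theorem Run.with_loaded {c : Config V} (u : V) {D F : Set V} {Z Y : Set (V × V)} {k : ℕ}
    (hu : c.fast u = none) (hus : c.slow u = some (parents E u)) (hc : c.dom ⊆ F) (huF : u ∈ F)
    (hM : F.encard ≤ M) (hZ : HeadsIn Z D) (huD : u ∉ D)
    (h : Run E M (c.complete E {u}) ((c.complete E {u}).add Z Y) k) :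
    Run E M c (c.add Z Y) (1 + k) := by
  have h1 : Run E M c (c.loaded ({u} : Finset V)) 1 := by
    refine Run.loaded_card {u} (by simp [hu]) ((Set.encard_le_encard ?_).trans hM)
    simpa [Set.insert_subset_iff, huF] using hc
  rw [Config.loaded_eq_complete (E := E) (by simp [hus])] at h1
  refine Run.with_complete {u} (by simp [hu]) h1 ?_ hZ (by simpa using huD)
  simpa using h

/-- A computation with a temporary value of the node `p` that is computed from its parents `u`
and `w`. -/
theorem Run.with_product {c : Config V} {p u w : V} {D F : Set V} {Z Y : Set (V × V)} {k : ℕ}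
    (hp : c.fast p = none) (hE : ∀ x, E x p ↔ x = u ∨ x = w)
    (hu : c.fast u = some (parents E u)) (hw : c.fast w = some (parents E w))
    (hwp : w ≠ p)
    (hc : c.dom ⊆ F) (hpF : p ∈ F) (hM : F.encard ≤ M) (hZ : HeadsIn Z D) (hpD : p ∉ D)
    (h : Run E M (c.complete E {p}) ((c.complete E {p}).add Z Y) k) :
    Run E M c (c.add Z Y) k := by
  have h1 : Run E M c (c.add {(u, p)} ∅) 0 := Run.aggregate ((hE u).2 (.inl rfl)) hu hc hpF hM
  have hH : HeadsIn {(u, p)} {p} := by rintro _ rfl; rfl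
  have h2 : Run E M (c.add {(u, p)} ∅) ((c.add {(u, p)} ∅).add {(w, p)} ∅) 0 := by
    refine Run.aggregate ((hE w).2 (.inr rfl)) ?_ ?_ hpF hM
    · rw [c.fast_add_of_headsIn ∅ hH (by simpa using hwp), hw]
    · intro x hx
      by_cases e : x = p
      · exact e ▸ hpF
      · rw [Config.mem_dom, c.fast_add_of_headsIn ∅ hH (by simpa using e)] at hx
        exact hc hx
  have h3 := h1.trans h2
  have he : ({(u, p)} ∪ {(w, p)} : Set (V × V)) = edgesInto E {p} := by
    ext ⟨x, y⟩
    simp only [edgesInto, Set.mem_union, Set.mem_singleton_iff, Prod.mk.injEq, Set.mem_ofPred_eq]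
    constructor
    · rintro (⟨rfl, rfl⟩ | ⟨rfl, rfl⟩) <;> simp [hE]
    · rintro ⟨rfl, hx⟩
      simpa [hE] using hx
  rw [Config.add_add, he, Set.union_empty, Config.add_edgesInto
    (by rintro v rfl; exact .inl ⟨hp, u, (hE u).2 (.inl rfl)⟩)] at h3
  have h4 := Run.with_complete (Z := Z) (Y := Y) (c := c) {p} (by simp [hp])
    (by simpa using h3) (by simpa using h) hZ (by simpa using hpD)
  simpa using h4

end Pebble

/-! ### Upper bound: computing sets of nodes from stored parents -/

namespace Pebble

variable {V : Type*} {E : V → V → Prop} {M : ℕ}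

theorem encard_insert_le_of_add_le {F : Set V} {k : ℕ} (h : F.encard + (k + 1 : ℕ) ≤ M) (x : V) :
    (insert x F).encard + k ≤ M := by
  refine le_trans ?_ h
  rw [Nat.cast_add, Nat.cast_one, add_comm (k : ℕ∞), ← add_assoc]
  gcongr
  exact Set.encard_insert_le F x

/-- The complete aggregation of the nodes in `T`, whose parents are loaded one after the other. -/
theorem Run.add_edgesInto {c : Config V} (T P : Finset V) {F : Set V} (hc : c.dom ⊆ F)
    (hTF : (T : Set V) ⊆ F) (hM : F.encard + 1 ≤ M) (hP : ∀ v ∈ T, ∀ u, E u v → u ∈ P)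
    (hPF : ∀ u ∈ P, u ∉ F) (hPs : ∀ u ∈ P, c.slow u = some (parents E u)) :
    Run E M c (c.add (edgesInto E T) ∅) P.card := by
  classical
  -- Grouping the edges by their tails lets each parent be loaded once for all its children, with a
  -- single spare cell.
  have hZ : edgesInto E (T : Set V) = ⋃ u ∈ P, ⋃ v ∈ T.filter (E u ·), {(u, v)} := by
    ext ⟨u, v⟩
    simp only [edgesInto, Finset.mem_coe, Set.mem_ofPred_eq, Finset.mem_filter, Set.mem_iUnion,
      Set.mem_singleton_iff, Prod.mk.injEq, exists_prop]
    constructor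
    · rintro ⟨hv, hu⟩
      exact ⟨u, hP v hv u hu, v, ⟨hv, hu⟩, rfl, rfl⟩
    · rintro ⟨u', hu, v', ⟨hv, huv⟩, rfl, rfl⟩
      exact ⟨hv, huv⟩
  have hH : ∀ u v, v ∈ T.filter (E u ·) → HeadsIn {(u, v)} (T : Set V) := by
    rintro u v hv _ rfl
    exact (Finset.mem_filter.1 hv).1
  have hH' : ∀ u, HeadsIn (⋃ v ∈ T.filter (E u ·), {(u, v)}) (T : Set V) := by
    intro u p hp
    simp only [Set.mem_iUnion, exists_prop] at hp
    obtain ⟨v, hv, hp⟩ := hp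
    exact hH u v hv p hp
  rw [hZ, ← mul_one P.card]
  refine Run.add_biUnion_fast P _ (D := T) (fun u _ => hH' u) fun u hu c' hc' => ?_
  have hdom := hc'.dom_subset hc hTF
  have huT : u ∉ (T : Set V) := fun h => hPF u hu (hTF h)
  have hM' : (insert u F).encard ≤ M := by
    simpa using encard_insert_le_of_add_le (k := 0) (by simpa using hM) u
  refine Run.with_loaded u (D := T) (F := insert u F) (Config.fast_eq_none hdom (hPF u hu)) ?_
    (hdom.trans (Set.subset_insert _ _)) (Set.mem_insert _ _) hM' (hH' u) huT (k := 0) ?_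
  · rw [hc'.2 u (by simp), hPs u hu]
  rw [← mul_zero (T.filter (E u ·)).card]
  refine Run.add_biUnion_fast _ _ (D := T) (hH u) fun v hv c'' hc'' => ?_
  rw [Finset.mem_filter] at hv
  refine Run.aggregate (D := insert u F) hv.2 ?_ ?_ (.inr (hTF hv.1)) hM'
  · rw [hc''.1 u huT, Config.fast_complete_of_mem _ (Set.mem_singleton u)]
  · refine hc''.dom_subset ?_ (hTF.trans (Set.subset_insert _ _))
    refine (Config.dom_complete_subset _ _).trans (Set.union_subset ?_ ?_)
    · exact hdom.trans (Set.subset_insert _ _)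
    · rintro _ rfl
      exact Set.mem_insert _ _

/-- The nodes in `T` are computed from their parents and saved. -/
theorem Run.add_slow_edgesInto {c : Config V} (T P : Finset V) (hc : c.dom = ∅)
    (hM : T.card + 1 ≤ M) (hP : ∀ v ∈ T, ∀ u, E u v → u ∈ P)
    (hPT : ∀ u ∈ P, u ∉ T) (hPs : ∀ u ∈ P, c.slow u = some (parents E u)) :
    Run E M c (c.add ∅ (edgesInto E T)) (2 * T.card + P.card) := by
  have hcap : (T : Set V).encard + 1 ≤ M := by
    rw [Set.encard_coe_eq_coe_finsetCard]
    exact_mod_cast hM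
  refine Run.add_slow T (fun v _ => Config.fast_eq_none hc.subset id) ?_ ?_
    (headsIn_edgesInto _)
  · rw [hc, Set.empty_union]
    exact le_self_add.trans hcap
  · refine Run.add_edgesInto T P (F := T) ?_ subset_rfl hcap hP hPT hPs
    exact (Config.dom_loaded_subset _ _).trans (by simp [hc])

open Classical in
/-- The configuration with empty fast memory in which the sources and the complete values of the
nodes in `S` are in slow memory. -/
noncomputable def stored (E : V → V → Prop) (S : Set V) : Config V where
  fast _ := none
  slow v := if v ∈ S ∨ IsSource E v then some (parents E v) else none

theorem initial_eq_stored : initial E = stored E ∅ := by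
  classical
  apply Config.ext
  · intro v; rfl
  · intro v
    simp only [initial, stored, Set.mem_empty_iff_false, false_or]
    split_ifs with h
    · exact congrArg some (Set.eq_empty_of_forall_notMem h).symm
    · rfl

theorem slow_stored {S : Set V} {v : V} (hv : v ∈ S ∨ IsSource E v) :
    (stored E S).slow v = some (parents E v) := if_pos hv

theorem slow_stored_of_not {S : Set V} {v : V} (hv : ¬(v ∈ S ∨ IsSource E v)) :
    (stored E S).slow v = none := if_neg hv

theorem dom_stored (S : Set V) : (stored E S).dom = ∅ := by
  ext v
  simp [Config.mem_dom, stored]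

theorem stored_add (S T : Set V) : (stored E S).add ∅ (edgesInto E T) = stored E (S ∪ T) := by
  apply Config.ext
  · intro v; simp [stored]
  · intro v
    by_cases hT : v ∈ T
    · rw [slow_stored (.inl (.inr hT))]
      simp only [Config.add, tails_edgesInto hT]
      by_cases hS : v ∈ S ∨ IsSource E v
      · rw [slow_stored hS]
        rcases (parents E v).eq_empty_or_nonempty with h | h
        · simp [h]
        · simp [aggregated_of_nonempty _ h]
      · rw [slow_stored_of_not hS, aggregated_none]
        simp only [not_or, IsSource, not_forall, not_not] at hS
        exact hS.2
    · rw [Config.slow_add_of_headsIn _ _ (headsIn_edgesInto T) hT]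
      have : v ∈ S ∪ T ∨ IsSource E v ↔ v ∈ S ∨ IsSource E v := by simp [hT]
      by_cases h : v ∈ S ∨ IsSource E v
      · rw [slow_stored h, slow_stored (this.2 h)]
      · rw [slow_stored_of_not h, slow_stored_of_not (mt this.1 h)]

/-- The nodes in the sets `T x` are computed from stored parents, one set after the other. -/
theorem Run.store {α : Type*} (s : Finset α) (T P : α → Finset V) {S S' : Set V} {t e : ℕ}
    (hS' : S' = S ∪ ⋃ x ∈ s, (T x : Set V)) (htM : t + 1 ≤ M)
    (hT : ∀ x ∈ s, (T x).card ≤ t) (hPe : ∀ x ∈ s, (P x).card ≤ e)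
    (hP : ∀ x ∈ s, ∀ v ∈ T x, ∀ u, E u v → u ∈ P x)
    (hPS : ∀ x ∈ s, ∀ u ∈ P x, u ∈ S ∨ IsSource E u)
    (hPT : ∀ x ∈ s, ∀ u ∈ P x, ∀ y ∈ s, u ∉ T y) :
    Run E M (stored E S) (stored E S') (s.card * (2 * t + e)) := by
  have hU : (⋃ x ∈ s, edgesInto E (T x : Set V)) = edgesInto E (⋃ x ∈ s, (T x : Set V)) := by
    ext p
    simp only [edgesInto, Set.mem_iUnion, Set.mem_ofPred_eq, exists_prop, Finset.mem_coe]
    exact ⟨fun ⟨x, hx, h, h'⟩ => ⟨⟨x, hx, h⟩, h'⟩, fun ⟨⟨x, hx, h⟩, h'⟩ => ⟨x, hx, h, h'⟩⟩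
  rw [hS', ← stored_add, ← hU]
  refine Run.add_biUnion_slow s _ (D := ⋃ x ∈ s, (T x : Set V)) (fun x hx => ?_)
    fun x hx c' hc' => ?_
  · exact (headsIn_edgesInto _).mono (Set.subset_biUnion_of_mem (u := fun x => (T x : Set V)) hx)
  refine (Run.add_slow_edgesInto (T x) (P x) ?_ ?_ (hP x hx) (fun u hu => hPT x hx u hu x hx)
    fun u hu => ?_).mono ?_
  · exact Set.eq_empty_of_subset_empty (hc'.dom_subset (dom_stored S).subset subset_rfl)
  · have := hT x hx
    omega
  · rw [hc'.2 u, slow_stored (hPS x hx u hu)]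
    simp only [Set.mem_iUnion, not_exists]
    exact fun y hy => hPT x hx u hu y hy
  · have := hT x hx
    have := hPe x hx
    omega

/-- The nodes `f x` are computed from stored parents, one after the other. -/
theorem Run.store_each {α : Type*} (s : Finset α) (f : α → V) (P : α → Finset V) {S S' : Set V}
    {e : ℕ} (hS' : S' = S ∪ {v | ∃ x ∈ s, v = f x}) (hM : 2 ≤ M)
    (hPe : ∀ x ∈ s, (P x).card ≤ e) (hP : ∀ x ∈ s, ∀ u, E u (f x) → u ∈ P x)
    (hPS : ∀ x ∈ s, ∀ u ∈ P x, u ∈ S ∨ IsSource E u)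
    (hPT : ∀ x ∈ s, ∀ u ∈ P x, ∀ y ∈ s, u ≠ f y) :
    Run E M (stored E S) (stored E S') (s.card * (2 + e)) := by
  refine Run.store s (fun x => {f x}) P ?_ (t := 1) (by omega) (by simp) hPe (by simpa using hP) hPS
    (by simpa using hPT)
  rw [hS']
  congr 1
  ext v
  simp

end Pebble

/-! ### Upper bound: the naive strategy -/

namespace ApproxAttention

open Pebble

variable {n d g M : ℕ}

theorem isSource_q (i : Fin n) (l : Fin d) : IsSource Edge (.q i l : Node n d g) :=
  fun _ h => by cases h

theorem isSource_k (i : Fin n) (l : Fin d) : IsSource Edge (.k i l : Node n d g) :=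
  fun _ h => by cases h

theorem isSource_v (i : Fin n) (l : Fin d) : IsSource Edge (.v i l : Node n d g) :=
  fun _ h => by cases h

/-- The entries of `U₁` and `U₂`. -/
def factorNodes (n d g : ℕ) : Set (Node n d g) := {x | ∃ i m, x = .u₁ i m ∨ x = .u₂ i m}

/-- The entries of `U₁ H` and `D`. -/
def outNodes (n d g : ℕ) : Set (Node n d g) := {x | ∃ i j, x = .o i j}

open Classical in
theorem run_results (hM : 2 ≤ M) {S : Set (Node n d g)} (hS : outNodes n d g ⊆ S) :
    Run Edge M (stored Edge S) (stored Edge (S ∪ {x | ∃ i j, x = .a i j})) (n * d * 4) := by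
  have h := Run.store_each (M := M) (E := Edge) (S := S)
    (Finset.univ : Finset (Fin n × Fin d)) (fun x => .a x.1 x.2)
    (fun x => {.o x.1 (some x.2), .o x.1 none}) (e := 2) rfl hM
    (fun _ _ => Finset.card_le_two) (fun x _ u hu => by cases hu <;> simp)
    (fun x _ u hu => by
      simp only [Finset.mem_insert, Finset.mem_singleton] at hu
      rcases hu with rfl | rfl <;> exact .inl (hS ⟨_, _, rfl⟩))
    (fun x _ u hu => by
      simp only [Finset.mem_insert, Finset.mem_singleton] at hu
      rcases hu with rfl | rfl <;> simp)
  simpa using h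

/-- Apart from outputs, results and sources, which are all stored, every node has a child; for the
entries of `H` this uses `0 < n`. -/
theorem ioCost_le_of_run (hM : 2 ≤ M) (hn : 0 < n) (hd : 0 < d) (hg : 0 < g)
    {S : Set (Node n d g)} {k : ℕ} (hS : outNodes n d g ⊆ S)
    (h : Run Edge M (stored Edge ∅) (stored Edge S) k) :
    ioCost n d g M ≤ (k + n * d * 4 : ℕ) := by
  refine optimalCost_le_of_run (c := stored Edge (S ∪ {x | ∃ i j, x = .a i j})) ?_ ?_
  · rw [initial_eq_stored]
    exact h.trans (run_results hM hS)
  intro x hx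
  refine slow_stored ?_
  let m₀ : Monomial d g :=
    ⟨fun l => if l = ⟨0, hd⟩ then 1 else 0, by
      simp only [apply_ite Fin.val, Fin.val_zero, Finset.sum_ite_eq', Finset.mem_univ, if_true]
      rw [Fin.val_one']
      exact (Nat.mod_le _ _).trans hg⟩
  cases x with
  | q i l => exact .inr (isSource_q i l)
  | k i l => exact .inr (isSource_k i l)
  | v i l => exact .inr (isSource_v i l)
  | u₁ i m => exact absurd (.u₁_mulO i m none) (hx _)
  | u₂ i m => exact absurd (.u₂_h m i) (hx _)
  | mulH m i j => exact absurd (.mulH_h m i j) (hx _)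
  | h m j => exact absurd (.h_mulO ⟨0, hn⟩ m j) (hx _)
  | mulO i m j => exact absurd (.mulO_o i m j) (hx _)
  | o i j => exact .inl (.inl (hS ⟨i, j, rfl⟩))
  | a i j => exact .inl (.inr ⟨i, j, rfl⟩)

open Classical in
/-- The cost of the computation that stores every value and loads it for every use. -/
theorem ioCost_le_naive (hM : 2 ≤ M) (hn : 0 < n) (hd : 0 < d) (hg : 0 < g) :
    ioCost n d g M ≤ (34 * (n * rank d g * d) : ℕ) := by
  set r := rank d g with hr
  have hcard : Fintype.card (Monomial d g) = r := card_monomial d g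
  have hr0 : 0 < r := Nat.choose_pos (Nat.le_add_left g d)
  let S₁ : Set (Node n d g) := {x | ∃ i m, x = .u₁ i m}
  let S₂ : Set (Node n d g) := S₁ ∪ {x | ∃ i m, x = .u₂ i m}
  let S₃ : Set (Node n d g) := S₂ ∪ {x | ∃ m i j, x = .mulH m i j}
  let S₄ : Set (Node n d g) := S₃ ∪ {x | ∃ m j, x = .h m j}
  let S₅ : Set (Node n d g) := S₄ ∪ {x | ∃ i m j, x = .mulO i m j}
  have h₁ : Run Edge M (stored Edge ∅) (stored Edge S₁) (n * r * (2 + d)) := by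
    have h := Run.store_each (M := M) (E := Edge) (S := ∅) (S' := S₁)
      (Finset.univ : Finset (Fin n × Monomial d g)) (fun x => .u₁ x.1 x.2)
      (fun x => Finset.univ.image fun l => .q x.1 l) (e := d) (by simp [S₁]) hM
      (fun _ _ => Finset.card_image_le.trans (by simp)) (fun x _ u hu => by cases hu; simp)
      (fun x _ u hu => by
        obtain ⟨l, _, rfl⟩ := Finset.mem_image.1 hu
        exact .inr (isSource_q _ l))
      (fun x _ u hu => by
        obtain ⟨l, _, rfl⟩ := Finset.mem_image.1 hu
        simp)
    simpa [hcard] using h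
  have h₂ : Run Edge M (stored Edge S₁) (stored Edge S₂) (n * r * (2 + d)) := by
    have h := Run.store_each (M := M) (E := Edge) (S := S₁) (S' := S₂)
      (Finset.univ : Finset (Fin n × Monomial d g)) (fun x => .u₂ x.1 x.2)
      (fun x => Finset.univ.image fun l => .k x.1 l) (e := d) (by simp [S₂]) hM
      (fun _ _ => Finset.card_image_le.trans (by simp)) (fun x _ u hu => by cases hu; simp)
      (fun x _ u hu => by
        obtain ⟨l, _, rfl⟩ := Finset.mem_image.1 hu
        exact .inr (isSource_k _ l))
      (fun x _ u hu => by
        obtain ⟨l, _, rfl⟩ := Finset.mem_image.1 hu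
        simp)
    simpa [hcard] using h
  have h₃ : Run Edge M (stored Edge S₂) (stored Edge S₃) (r * n * d * 4) := by
    have h := Run.store_each (M := M) (E := Edge) (S := S₂) (S' := S₃)
      (Finset.univ : Finset ((Monomial d g × Fin n) × Fin d)) (fun x => .mulH x.1.1 x.1.2 x.2)
      (fun x => {.u₂ x.1.2 x.1.1, .v x.1.2 x.2}) (e := 2) (by simp [S₃]) hM
      (fun _ _ => Finset.card_le_two) (fun x _ u hu => by cases hu <;> simp)
      (fun x _ u hu => by
        simp only [Finset.mem_insert, Finset.mem_singleton] at hu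
        rcases hu with rfl | rfl
        · exact .inl (.inr ⟨_, _, rfl⟩)
        · exact .inr (isSource_v _ _))
      (fun x _ u hu => by
        simp only [Finset.mem_insert, Finset.mem_singleton] at hu
        rcases hu with rfl | rfl <;> simp)
    simpa [hcard] using h
  have h₄ : Run Edge M (stored Edge S₃) (stored Edge S₄) (r * (d + 1) * (2 + n)) := by
    have h := Run.store_each (M := M) (E := Edge) (S := S₃) (S' := S₄)
      (Finset.univ : Finset (Monomial d g × Option (Fin d))) (fun x => .h x.1 x.2)
      (fun x => Finset.univ.image fun i => match x.2 with
        | some j => .mulH x.1 i j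
        | none => .u₂ i x.1) (e := n) (by simp [S₄]) hM
      (fun _ _ => Finset.card_image_le.trans (by simp))
      (fun x _ u hu => by
        obtain ⟨m, j⟩ := x
        cases hu <;> simp)
      (fun x _ u hu => by
        obtain ⟨i, _, rfl⟩ := Finset.mem_image.1 hu
        obtain ⟨m, _ | j⟩ := x
        · exact .inl (.inl (.inr ⟨_, _, rfl⟩))
        · exact .inl (.inr ⟨_, _, _, rfl⟩))
      (fun x _ u hu => by
        obtain ⟨i, _, rfl⟩ := Finset.mem_image.1 hu
        obtain ⟨m, _ | j⟩ := x <;> simp)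
    simpa [hcard] using h
  have h₅ : Run Edge M (stored Edge S₄) (stored Edge S₅) (n * r * (d + 1) * 4) := by
    have h := Run.store_each (M := M) (E := Edge) (S := S₄) (S' := S₅)
      (Finset.univ : Finset ((Fin n × Monomial d g) × Option (Fin d)))
      (fun x => .mulO x.1.1 x.1.2 x.2)
      (fun x => {.u₁ x.1.1 x.1.2, .h x.1.2 x.2}) (e := 2) (by simp [S₅]) hM
      (fun _ _ => Finset.card_le_two) (fun x _ u hu => by cases hu <;> simp)
      (fun x _ u hu => by
        simp only [Finset.mem_insert, Finset.mem_singleton] at hu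
        rcases hu with rfl | rfl
        · exact .inl (.inl (.inl (.inl ⟨_, _, rfl⟩)))
        · exact .inl (.inr ⟨_, _, rfl⟩))
      (fun x _ u hu => by
        simp only [Finset.mem_insert, Finset.mem_singleton] at hu
        rcases hu with rfl | rfl <;> simp)
    simpa [hcard] using h
  have h₆ : Run Edge M (stored Edge S₅) (stored Edge (S₅ ∪ outNodes n d g))
      (n * (d + 1) * (2 + r)) := by
    have h := Run.store_each (M := M) (E := Edge) (S := S₅) (S' := S₅ ∪ outNodes n d g)
      (Finset.univ : Finset (Fin n × Option (Fin d))) (fun x => .o x.1 x.2)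
      (fun x => Finset.univ.image fun m => .mulO x.1 m x.2) (e := r) (by simp [outNodes]) hM
      (fun _ _ => Finset.card_image_le.trans (by simp [hcard]))
      (fun x _ u hu => by cases hu; simp)
      (fun x _ u hu => by
        obtain ⟨m, _, rfl⟩ := Finset.mem_image.1 hu
        exact .inl (.inr ⟨_, _, _, rfl⟩))
      (fun x _ u hu => by
        obtain ⟨l, _, rfl⟩ := Finset.mem_image.1 hu
        simp)
    simpa using h
  refine (ioCost_le_of_run hM hn hd hg Set.subset_union_right
    (((((h₁.trans h₂).trans h₃).trans h₄).trans h₅).trans h₆)).trans ?_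
  norm_cast
  -- For positive `n`, `r`, `d` the six stages and the results cost at most `3 + 3 + 4 + 6 + 8 + 6 +
  -- 4 = 34` times `n * r * d`.
  obtain ⟨n, rfl⟩ : ∃ n', n = n' + 1 := ⟨n - 1, by omega⟩
  obtain ⟨d, rfl⟩ : ∃ d', d = d' + 1 := ⟨d - 1, by omega⟩
  obtain ⟨r, hr'⟩ : ∃ r', r = r' + 1 := ⟨r - 1, by omega⟩
  rw [hr']
  ring_nf
  nlinarith [Nat.zero_le (n * d * r), Nat.zero_le (n * d), Nat.zero_le (n * r),
    Nat.zero_le (d * r)]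

end ApproxAttention

/-! ### Upper bound: the tiled strategy -/

namespace ApproxAttention

open Pebble

variable {n d g M : ℕ}

/-- A block of the matrix `H` (with the column `U₂ᵀ 1`). -/
def tile (n : ℕ) (A : Finset (Monomial d g)) (J : Finset (Option (Fin d))) : Set (Node n d g) :=
  {x | ∃ m ∈ A, ∃ j ∈ J, x = .h m j}

/-- A block of row `i` of `U₁`. -/
def queryBlock (i : Fin n) (A : Finset (Monomial d g)) : Set (Node n d g) :=
  {x | ∃ m ∈ A, x = .u₁ i m}

/-- A block of row `i` of `U₂`. -/
def keyBlock (i : Fin n) (A : Finset (Monomial d g)) : Set (Node n d g) :=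
  {x | ∃ m ∈ A, x = .u₂ i m}

/-- The summand in row `i` of the entry `(m, j)` of `H` or `U₂ᵀ 1`. -/
def summand (i : Fin n) (m : Monomial d g) : Option (Fin d) → Node n d g
  | some j => .mulH m i j
  | none => .u₂ i m

theorem edge_summand (i : Fin n) (m : Monomial d g) (j : Option (Fin d)) :
    Edge (summand i m j) (.h m j) := by
  cases j with
  | none => exact .u₂_h m i
  | some j => exact .mulH_h m i j

theorem edge_h_iff {x : Node n d g} {m : Monomial d g} {j : Option (Fin d)} :
    Edge x (.h m j) ↔ ∃ i, x = summand i m j := by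
  constructor
  · intro h
    cases h with
    | mulH_h _ i _ => exact ⟨i, rfl⟩
    | u₂_h _ i => exact ⟨i, rfl⟩
  · rintro ⟨i, rfl⟩
    exact edge_summand i m j

theorem edge_o_iff {x : Node n d g} {i : Fin n} {j : Option (Fin d)} :
    Edge x (.o i j) ↔ ∃ m, x = .mulO i m j := by
  constructor
  · intro h
    cases h with | mulO_o _ m _ => exact ⟨m, rfl⟩
  · rintro ⟨m, rfl⟩
    exact .mulO_o i m j

theorem edge_mulH_iff {x : Node n d g} {m : Monomial d g} {i : Fin n} {j : Fin d} :
    Edge x (.mulH m i j) ↔ x = .u₂ i m ∨ x = .v i j := by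
  constructor
  · intro h
    cases h <;> simp
  · rintro (rfl | rfl)
    exacts [.u₂_mulH m i j, .v_mulH m i j]

theorem edge_mulO_iff {x : Node n d g} {i : Fin n} {m : Monomial d g} {j : Option (Fin d)} :
    Edge x (.mulO i m j) ↔ x = .u₁ i m ∨ x = .h m j := by
  constructor
  · intro h
    cases h <;> simp
  · rintro (rfl | rfl)
    exacts [.u₁_mulO i m j, .h_mulO i m j]

section Tile

variable {A : Finset (Monomial d g)} {J : Finset (Option (Fin d))}

theorem headsIn_biUnion {V α : Type*} {s : Finset α} {Z : α → Set (V × V)} {D : Set V}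
    (h : ∀ x ∈ s, HeadsIn (Z x) D) : HeadsIn (⋃ x ∈ s, Z x) D := by
  intro p hp
  simp only [Set.mem_iUnion, exists_prop] at hp
  obtain ⟨x, hx, hp⟩ := hp
  exact h x hx p hp

theorem headsIn_singleton {V : Type*} {u v : V} {D : Set V} (h : v ∈ D) : HeadsIn {(u, v)} D := by
  rintro _ rfl
  exact h

theorem encard_add_one_le {V : Type*} {F : Set V} {N k : ℕ} (h : F.encard + (k + 1 : ℕ) ≤ N) :
    F.encard ≤ N := le_self_add.trans h

/-- The contribution of row `i` to a part of a column of a block of `H`. -/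
theorem run_tile_column {c : Config (Node n d g)} {i : Fin n} {j : Option (Fin d)} (hj : j ∈ J)
    {F : Set (Node n d g)} (hF : F = tile n A J ∪ keyBlock i A) (hc : c.dom ⊆ F)
    (hM : F.encard + 2 ≤ M) (hu : ∀ m ∈ A, c.fast (.u₂ i m) = some (parents Edge (.u₂ i m)))
    (hv : ∀ j, c.slow (.v i j) = some (parents Edge (.v i j))) :
    Run Edge M c (c.add (⋃ m ∈ A, {(summand i m j, .h m j)}) ∅) 1 := by
  have hH : ∀ m ∈ A, HeadsIn {(summand i m j, .h m j)} (tile n A J) :=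
    fun m hm => headsIn_singleton ⟨m, hm, j, hj, rfl⟩
  have hTF : tile n A J ⊆ F := hF ▸ Set.subset_union_left
  have hFh : ∀ m ∈ A, .h m j ∈ F := fun m hm => hTF ⟨m, hm, j, hj, rfl⟩
  cases j with
  | none =>
    -- For the all-ones column the entry of `U₂` is itself the summand, so nothing is loaded.
    refine Run.mono (k := A.card * 0) ?_ (by simp)
    refine Run.add_biUnion_fast A _ hH fun m hm c' hc' => ?_
    refine Run.aggregate (D := F) (edge_summand i m none) ?_ (hc'.dom_subset hc hTF) (hFh m hm)
      (encard_add_one_le (k := 1) hM)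
    simp only [summand]
    rw [hc'.1 _ (by simp [tile]), hu m hm]
  | some j =>
    -- The two spare cells hold the entry of `V` and one product at a time.
    have hM₁ : (insert (.v i j) F).encard + (0 + 1 : ℕ) ≤ M :=
      encard_insert_le_of_add_le (k := 1) hM _
    have hvF : .v i j ∉ F := by simp [hF, tile, keyBlock]
    refine Run.with_loaded (.v i j) (D := tile n A J) (F := insert (.v i j) F) (k := 0)
      (Config.fast_eq_none hc hvF) (hv j) (hc.trans (Set.subset_insert _ _)) (Set.mem_insert _ _)
      (encard_add_one_le hM₁) (headsIn_biUnion hH) (by simp [tile]) ?_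
    rw [← mul_zero A.card]
    refine Run.add_biUnion_fast A _ hH fun m hm c' hc' => ?_
    have hdom : c'.dom ⊆ insert (.v i j) F := by
      refine hc'.dom_subset ((Config.dom_complete_subset _ _).trans ?_)
        (hTF.trans (Set.subset_insert _ _))
      rintro x (hx | rfl)
      · exact .inr (hc hx)
      · exact .inl rfl
    have hmF : .mulH m i j ∉ insert (.v i j) F := by simp [hF, tile, keyBlock]
    have hM₂ : (insert (.mulH m i j) (insert (.v i j) F)).encard ≤ M := by
      simpa using encard_insert_le_of_add_le (k := 0) hM₁ (.mulH m i j)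
    refine Run.with_product (p := .mulH m i j) (u := .u₂ i m) (w := .v i j) (D := tile n A J)
      (Config.fast_eq_none hdom hmF) (fun _ => edge_mulH_iff) ?_ ?_ (by simp)
      (hdom.trans (Set.subset_insert _ _)) (Set.mem_insert _ _) hM₂ (hH m hm) (by simp [tile]) ?_
    · rw [hc'.1 _ (by simp [tile]), Config.fast_complete_of_notMem _ (by simp), hu m hm]
    · rw [hc'.1 _ (by simp [tile]), Config.fast_complete_of_mem _ (Set.mem_singleton _)]
    · refine Run.aggregate (edge_summand i m (some j))
        (Config.fast_complete_of_mem (E := Edge) c' (Set.mem_singleton _)) ?_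
        (.inr (.inr (hFh m hm))) hM₂
      refine (Config.dom_complete_subset _ _).trans ?_
      rintro x (hx | rfl)
      · exact .inr (hdom hx)
      · exact .inl rfl

/-- The computation of a block of `H`. -/
theorem run_tile {c : Config (Node n d g)} {κ a : ℕ} (hn : 0 < n) (hc : c.dom = ∅)
    (hM : (tile n A J).encard + (a + 2 : ℕ) ≤ M) (hA : A.card ≤ a)
    (hv : ∀ i j, c.slow (.v i j) = some (parents Edge (.v i j)))
    (hu : ∀ i, ∀ c', c'.slow = c.slow → c'.dom ⊆ tile n A J →
      Run Edge M c' (c'.complete Edge (keyBlock i A)) κ) :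
    Run Edge M c (c.complete Edge (tile n A J)) (n * (κ + J.card)) := by
  classical
  have hZ : (⋃ i ∈ (Finset.univ : Finset (Fin n)), ⋃ j ∈ J, ⋃ m ∈ A,
      {(summand i m j, (.h m j : Node n d g))}) = edgesInto Edge (tile n A J) := by
    ext ⟨x, y⟩
    simp only [Finset.mem_univ, Set.iUnion_true, Set.mem_iUnion, Set.mem_singleton_iff,
      Prod.mk.injEq, exists_prop, edgesInto, Set.mem_ofPred_eq, tile]
    constructor
    · rintro ⟨i, j, hj, m, hm, rfl, rfl⟩
      exact ⟨⟨m, hm, j, hj, rfl⟩, edge_summand i m j⟩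
    · rintro ⟨⟨m, hm, j, hj, rfl⟩, h⟩
      obtain ⟨i, rfl⟩ := edge_h_iff.1 h
      exact ⟨i, j, hj, m, hm, rfl, rfl⟩
  rw [← Config.add_edgesInto (T := tile n A J), ← hZ]
  · have hcard := Finset.card_univ (α := Fin n)
    rw [Fintype.card_fin] at hcard
    have hH : ∀ i : Fin n, HeadsIn (⋃ j ∈ J, ⋃ m ∈ A, {(summand i m j, .h m j)}) (tile n A J) :=
      fun i => headsIn_biUnion fun j hj => headsIn_biUnion fun m hm =>
        headsIn_singleton ⟨m, hm, j, hj, rfl⟩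
    rw [← congrArg (· * (κ + J.card)) hcard]
    refine Run.add_biUnion_fast _ _ (D := tile n A J) (fun i _ => hH i) fun i _ c' hc' => ?_
    have hdom : c'.dom ⊆ tile n A J := hc'.dom_subset (by simp [hc]) subset_rfl
    have hslow : c'.slow = c.slow := funext fun v => hc'.2 v (by simp)
    have hblock : keyBlock i A = ((A.image (.u₂ i) : Finset (Node n d g)) : Set (Node n d g)) := by
      ext x
      simp [keyBlock, eq_comm]
    have hM' : (tile n A J ∪ keyBlock i A).encard + 2 ≤ M := by
      refine le_trans ?_ hM
      have : (keyBlock i A : Set (Node n d g)).encard ≤ a := by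
        rw [hblock, Set.encard_coe_eq_coe_finsetCard]
        exact_mod_cast Finset.card_image_le.trans hA
      rw [Nat.cast_add, ← add_assoc]
      exact add_le_add ((Set.encard_union_le _ _).trans (add_le_add le_rfl this)) le_rfl
    have hget := hu i c' hslow hdom
    rw [hblock] at hget
    refine Run.with_complete (A.image (.u₂ i)) (D := tile n A J) (fun x hx => ?_) hget ?_ (hH i)
      fun x hx => ?_
    · obtain ⟨m, _, rfl⟩ := Finset.mem_image.1 hx
      exact Config.fast_eq_none hdom (by simp [tile])
    · rw [← hblock, ← mul_one J.card]
      have hcdom : (c'.complete Edge (keyBlock i A)).dom ⊆ tile n A J ∪ keyBlock i A :=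
        (Config.dom_complete_subset _ _).trans (Set.union_subset_union_left _ hdom)
      refine Run.add_biUnion_fast J _ (D := tile n A J) (fun j hj => headsIn_biUnion fun m hm =>
        headsIn_singleton ⟨m, hm, j, hj, rfl⟩) fun j hj c'' hc'' => ?_
      refine run_tile_column hj rfl (hc''.dom_subset hcdom Set.subset_union_left) hM' ?_ ?_
      · intro m hm
        rw [hc''.1 _ (by simp [tile]),
          Config.fast_complete_of_mem _ (show _ ∈ keyBlock i A from ⟨m, hm, rfl⟩)]
      · intro j
        rw [hc''.2 _ (by simp)]
        simp [Config.complete, hslow, hv]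
    · obtain ⟨m, _, rfl⟩ := Finset.mem_image.1 hx
      simp [tile]
  · rintro _ ⟨m, hm, j, hj, rfl⟩
    exact .inl ⟨Config.fast_eq_none hc.subset id, _, edge_summand ⟨0, hn⟩ m j⟩

/-- The contribution of a block of `H` to the entry `(i, j)` of the output. -/
theorem run_output_entry {c : Config (Node n d g)} {i : Fin n} {j : Option (Fin d)}
    {F : Set (Node n d g)} (hF : F = tile n A J ∪ queryBlock i A) (hc : c.dom ⊆ F)
    (hM : F.encard + 2 ≤ M) (hu : ∀ m ∈ A, c.fast (.u₁ i m) = some (parents Edge (.u₁ i m)))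
    (hh : ∀ m ∈ A, c.fast (.h m j) = some (parents Edge (.h m j))) :
    Run Edge M c (c.add ∅ (⋃ m ∈ A, {(.mulO i m j, .o i j)})) 2 := by
  classical
  have hM₁ : (insert (.o i j) F).encard + (0 + 1 : ℕ) ≤ M :=
    encard_insert_le_of_add_le (k := 1) hM _
  have hH : ∀ m ∈ A, HeadsIn {((.mulO i m j : Node n d g), .o i j)} ({.o i j}) :=
    fun m _ => headsIn_singleton rfl
  have hoF : .o i j ∉ F := by simp [hF, tile, queryBlock]
  have h := Run.add_slow (M := M) (E := Edge) (c := c) (k := 0) {.o i j}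
    (Z := ⋃ m ∈ A, {(.mulO i m j, .o i j)}) (by simpa using Config.fast_eq_none hc hoF) ?_ ?_ ?_
  · simpa using h
  · refine (Set.encard_le_encard ?_).trans (encard_add_one_le hM₁)
    simpa [Set.insert_subset_iff] using hc.trans (Set.subset_insert _ _)
  · rw [← mul_zero A.card]
    refine Run.add_biUnion_fast A _ hH fun m hm c' hc' => ?_
    have hdom : c'.dom ⊆ insert (.o i j) F := by
      refine hc'.dom_subset ((Config.dom_loaded_subset _ _).trans ?_) (by simp)
      rw [Finset.coe_singleton, Set.union_singleton]
      exact Set.insert_subset_insert hc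
    have hmF : .mulO i m j ∉ insert (.o i j) F := by simp [hF, tile, queryBlock]
    have hM₂ : (insert (.mulO i m j) (insert (.o i j) F)).encard ≤ M := by
      simpa using encard_insert_le_of_add_le (k := 0) hM₁ (.mulO i m j)
    refine Run.with_product (p := .mulO i m j) (u := .u₁ i m) (w := .h m j) (D := {.o i j})
      (Config.fast_eq_none hdom hmF) (fun _ => edge_mulO_iff) ?_ ?_ (by simp)
      (hdom.trans (Set.subset_insert _ _)) (Set.mem_insert _ _) hM₂ (hH m hm) (by simp) ?_
    · rw [hc'.1 _ (by simp), Config.fast_loaded_of_notMem _ (by simp), hu m hm]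
    · rw [hc'.1 _ (by simp), Config.fast_loaded_of_notMem _ (by simp), hh m hm]
    · refine Run.aggregate (.mulO_o i m j)
        (Config.fast_complete_of_mem (E := Edge) c' (Set.mem_singleton _)) ?_
        (.inr (.inl rfl)) hM₂
      refine (Config.dom_complete_subset _ _).trans ?_
      rintro x (hx | rfl)
      · exact .inr (hdom hx)
      · exact .inl rfl
  · simpa using headsIn_biUnion hH

/-- The contribution of a block of `H`, held in fast memory, to the output. -/
theorem run_tile_output {c : Config (Node n d g)} {κ a : ℕ} (hc : c.dom ⊆ tile n A J)
    (hM : (tile n A J).encard + (a + 2 : ℕ) ≤ M) (hA : A.card ≤ a)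
    (hh : ∀ x ∈ tile n A J, c.fast x = some (parents Edge x))
    (hu : ∀ i, ∀ c', c.AgreeOff c' ∅ (outNodes n d g) → c'.dom ⊆ tile n A J →
      Run Edge M c' (c'.complete Edge (queryBlock i A)) κ) :
    Run Edge M c (c.add ∅ (⋃ i ∈ (Finset.univ : Finset (Fin n)), ⋃ j ∈ J, ⋃ m ∈ A,
      {(.mulO i m j, .o i j)})) (n * (κ + J.card * 2)) := by
  classical
  have hcard := Finset.card_univ (α := Fin n)
  rw [Fintype.card_fin] at hcard
  rw [← congrArg (· * (κ + J.card * 2)) hcard]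
  have hH : ∀ (i : Fin n) j, HeadsIn (⋃ m ∈ A, {((.mulO i m j : Node n d g), .o i j)})
      (outNodes n d g) :=
    fun i j => headsIn_biUnion fun m _ => headsIn_singleton ⟨i, j, rfl⟩
  refine Run.add_biUnion_slow _ _ (D := outNodes n d g)
    (fun i _ => headsIn_biUnion fun j _ => hH i j) fun i _ c' hc' => ?_
  have hdom : c'.dom ⊆ tile n A J := hc'.dom_subset hc (Set.empty_subset _)
  have hblock : queryBlock i A = ((A.image (.u₁ i) : Finset (Node n d g)) : Set (Node n d g)) := by
    ext x
    simp [queryBlock, eq_comm]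
  have hM' : (tile n A J ∪ queryBlock i A).encard + 2 ≤ M := by
    refine le_trans ?_ hM
    have : (queryBlock i A : Set (Node n d g)).encard ≤ a := by
      rw [hblock, Set.encard_coe_eq_coe_finsetCard]
      exact_mod_cast Finset.card_image_le.trans hA
    rw [Nat.cast_add, ← add_assoc]
    exact add_le_add ((Set.encard_union_le _ _).trans (add_le_add le_rfl this)) le_rfl
  have hget := hu i c' hc' hdom
  rw [hblock] at hget
  refine Run.with_complete (A.image (.u₁ i)) (D := ∅) (fun x hx => ?_) hget ?_ (headsIn_empty _)
    (by simp)
  · obtain ⟨m, _, rfl⟩ := Finset.mem_image.1 hx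
    exact Config.fast_eq_none hdom (by simp [tile])
  · rw [← hblock]
    have hcdom : (c'.complete Edge (queryBlock i A)).dom ⊆ tile n A J ∪ queryBlock i A :=
      (Config.dom_complete_subset _ _).trans (Set.union_subset_union_left _ hdom)
    refine Run.add_biUnion_slow J _ (D := outNodes n d g) (fun j _ => hH i j)
      fun j hj c'' hc'' => ?_
    refine run_output_entry rfl (hc''.dom_subset hcdom (Set.empty_subset _)) hM' ?_ ?_
    · intro m hm
      rw [hc''.1 _ (by simp),
        Config.fast_complete_of_mem _ (show _ ∈ queryBlock i A from ⟨m, hm, rfl⟩)]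
    · intro m hm
      rw [hc''.1 _ (by simp), Config.fast_complete_of_notMem _ (by simp [queryBlock]),
        hc'.1 _ (by simp), hh _ ⟨m, hm, j, hj, rfl⟩]

end Tile

/-- The computation of the output from blocks of `H`, if blocks of rows of `U₁` and `U₂` can be
obtained at cost `κ`. -/
theorem run_blocks {S : Set (Node n d g)} {κ a b : ℕ} (hn : 0 < n)
    (P : Finset (Finset (Monomial d g))) (R : Finset (Finset (Option (Fin d))))
    (hP : ∀ m, ∃ A ∈ P, m ∈ A) (hR : ∀ j, ∃ J ∈ R, j ∈ J) (hPa : ∀ A ∈ P, A.card ≤ a)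
    (hRb : ∀ J ∈ R, J.card ≤ b) (hM : a * b + a + 2 ≤ M)
    (hget : ∀ A ∈ P, ∀ i, ∀ c : Config (Node n d g),
      (∀ x ∉ outNodes n d g, c.slow x = (stored Edge S).slow x) →
      (∀ x, (∀ m j, x ≠ .h m j) → c.fast x = none) → c.dom.encard + (a + 2 : ℕ) ≤ M →
      Run Edge M c (c.complete Edge (keyBlock i A)) κ ∧
      Run Edge M c (c.complete Edge (queryBlock i A)) κ) :
    Run Edge M (stored Edge S) (stored Edge (S ∪ outNodes n d g))
      (P.card * R.card * (n * (2 * κ + 3 * b))) := by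
  classical
  -- The tiles need only cover all pairs `(m, j)`; overlaps would do no harm.
  have hZ : (⋃ x ∈ P ×ˢ R, ⋃ i ∈ (Finset.univ : Finset (Fin n)), ⋃ j ∈ x.2, ⋃ m ∈ x.1,
      {((.mulO i m j : Node n d g), (.o i j : Node n d g))}) =
        edgesInto Edge (outNodes n d g) := by
    ext ⟨x, y⟩
    simp only [Finset.mem_univ, Set.iUnion_true, Set.mem_iUnion, Set.mem_singleton_iff,
      Prod.mk.injEq, exists_prop, edgesInto, Set.mem_ofPred_eq, outNodes]
    constructor
    · rintro ⟨-, -, i, j, -, m, -, rfl, rfl⟩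
      exact ⟨⟨i, j, rfl⟩, .mulO_o i m j⟩
    · rintro ⟨⟨i, j, rfl⟩, h⟩
      obtain ⟨m, rfl⟩ := edge_o_iff.1 h
      obtain ⟨A, hA, hm⟩ := hP m
      obtain ⟨J, hJ, hj⟩ := hR j
      exact ⟨(A, J), Finset.mem_product.2 ⟨hA, hJ⟩, i, j, hj, m, hm, rfl, rfl⟩
  have hH : ∀ (A : Finset (Monomial d g)) (J : Finset (Option (Fin d))),
      HeadsIn (⋃ i ∈ (Finset.univ : Finset (Fin n)), ⋃ j ∈ J, ⋃ m ∈ A,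
        {((.mulO i m j : Node n d g), (.o i j : Node n d g))}) (outNodes n d g) :=
    fun A J => headsIn_biUnion fun i _ => headsIn_biUnion fun j _ => headsIn_biUnion fun m _ =>
      headsIn_singleton ⟨i, j, rfl⟩
  rw [← stored_add, ← hZ, ← Finset.card_product]
  refine Run.add_biUnion_slow _ _ (D := outNodes n d g) (fun x _ => hH x.1 x.2)
    fun x hx c hc => ?_
  obtain ⟨hA, hJ⟩ := Finset.mem_product.1 hx
  obtain ⟨A, J⟩ := x
  simp only at hA hJ ⊢
  have hdom : c.dom = ∅ :=
    Set.eq_empty_of_subset_empty (hc.dom_subset (dom_stored S).subset subset_rfl)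
  have htile : tile n A J =
      (((A ×ˢ J).image fun p => .h p.1 p.2 : Finset (Node n d g)) : Set (Node n d g)) := by
    ext x
    simp only [tile, Set.mem_ofPred_eq, Finset.coe_image, Finset.coe_product, Set.mem_image,
      Set.mem_prod, Finset.mem_coe, Prod.exists]
    constructor
    · rintro ⟨m, hm, j, hj, rfl⟩
      exact ⟨m, j, ⟨hm, hj⟩, rfl⟩
    · rintro ⟨m, j, ⟨hm, hj⟩, rfl⟩
      exact ⟨m, hm, j, hj, rfl⟩
  have hcap : (tile n A J).encard + (a + 2 : ℕ) ≤ M := by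
    have h1 : (tile n A J).encard ≤ ((a * b : ℕ) : ℕ∞) := by
      rw [htile, Set.encard_coe_eq_coe_finsetCard, Nat.cast_le]
      refine Finset.card_image_le.trans ?_
      rw [Finset.card_product]
      exact Nat.mul_le_mul (hPa A hA) (hRb J hJ)
    refine (add_le_add h1 le_rfl).trans ?_
    exact_mod_cast (by omega : a * b + (a + 2) ≤ M)
  have hfast : ∀ c' : Config (Node n d g), c'.dom ⊆ tile n A J →
      (∀ x, (∀ m j, x ≠ .h m j) → c'.fast x = none) ∧ c'.dom.encard + (a + 2 : ℕ) ≤ M := by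
    refine fun c' hc' => ⟨fun x hx => Config.fast_eq_none hc' ?_,
      (add_le_add (Set.encard_le_encard hc') le_rfl).trans hcap⟩
    rintro ⟨m, -, j, -, rfl⟩
    exact hx m j rfl
  have h1 := run_tile (κ := κ) hn hdom hcap (hPa A hA)
    (fun i j => by rw [hc.2 _ (by simp [outNodes]), slow_stored (.inr (isSource_v i j))])
    (fun i c' hs hd => (hget A hA i c' (fun x hx => by rw [hs, hc.2 x hx])
      (hfast c' hd).1 (hfast c' hd).2).1)
  have hd2 : (c.complete Edge (tile n A J)).dom ⊆ tile n A J :=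
    (Config.dom_complete_subset _ _).trans (by simp [hdom])
  have h2 := run_tile_output (κ := κ) hd2 hcap (hPa A hA)
    (fun x hx => Config.fast_complete_of_mem _ hx)
    (fun i c' hs hd => (hget A hA i c' (fun x hx => by rw [hs.2 x hx]; exact hc.2 x hx)
      (hfast c' hd).1 (hfast c' hd).2).2)
  -- The tile of `H` is a temporary value: it is deleted after its use without ever being saved.
  have h3 := Run.with_complete (M := M) (E := Edge) (D := ∅)
    ((A ×ˢ J).image fun p => .h p.1 p.2) (c := c) (Z := ∅)
    (fun x _ => Config.fast_eq_none hdom.subset id) (by rw [← htile]; exact h1)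
    (by rw [← htile]; exact h2) (headsIn_empty _) (by simp)
  refine h3.mono ?_
  have := hRb J hJ
  rw [← mul_add]
  exact Nat.mul_le_mul_left _ (by omega)

end ApproxAttention

/-! ### Upper bound: supplying the blocks of `U₁` and `U₂`, and the total cost -/

namespace Pebble

variable {V : Type*} {E : V → V → Prop} {M : ℕ}

/-- A set of nodes is completed in fast memory. Those that are stored are loaded, the others are
computed from stored parents. -/
theorem Run.complete_block {c : Config V} {S : Set V} (T P : Finset V) {k : ℕ}
    (hM : c.dom.encard + (T.card + 1 : ℕ) ≤ M) (hT : ∀ v ∈ T, c.fast v = none)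
    (hTs : ∀ v ∈ T, c.slow v = (stored E S).slow v) (hP : ∀ v ∈ T, ∀ u, E u v → u ∈ P)
    (hPT : ∀ u ∈ P, u ∉ T) (hPf : ∀ u ∈ P, c.fast u = none)
    (hPs : ∀ u ∈ P, c.slow u = some (parents E u))
    (hk : {v | v ∈ T ∧ (v ∈ S ∨ IsSource E v)}.encard ≤ k) :
    Run E M c (c.complete E T) (k + P.card) := by
  have hcap : (c.dom ∪ T).encard + 1 ≤ M := by
    refine le_trans ?_ hM
    rw [Nat.cast_add, Nat.cast_one, ← add_assoc]
    gcongr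
    exact (Set.encard_union_le _ _).trans (by rw [Set.encard_coe_eq_coe_finsetCard])
  have hl : Run E M c (c.loaded T) k := by
    refine Run.loaded T hT (le_self_add.trans hcap) ((Set.encard_le_encard ?_).trans hk)
    rintro v ⟨hv, hs⟩
    refine ⟨hv, ?_⟩
    by_contra h
    exact hs (by rw [hTs v hv, slow_stored_of_not h])
  have ha : Run E M (c.loaded T) ((c.loaded T).add (edgesInto E T) ∅) P.card := by
    refine Run.add_edgesInto T P (F := c.dom ∪ T) (c.dom_loaded_subset _) Set.subset_union_right
      hcap hP ?_ hPs
    rintro u hu (h | h)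
    · exact h (hPf u hu)
    · exact hPT u hu h
  rw [Config.add_edgesInto] at ha
  · convert hl.trans ha using 1
    apply Config.ext
    · intro v
      by_cases h : v ∈ (T : Set V)
      · rw [Config.fast_complete_of_mem _ h, Config.fast_complete_of_mem _ h]
      · rw [Config.fast_complete_of_notMem _ h, Config.fast_complete_of_notMem _ h,
          Config.fast_loaded_of_notMem _ h]
    · intro v
      rfl
  · intro v hv
    rw [Config.fast_loaded_of_mem _ hv, hTs v hv]
    by_cases h : v ∈ S ∨ IsSource E v
    · exact .inr (slow_stored h)
    · refine .inl ⟨slow_stored_of_not h, ?_⟩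
      simp only [not_or, IsSource, not_forall, not_not] at h
      exact h.2

theorem Run.load_block {c : Config V} (T : Finset V)
    (hM : c.dom.encard + (T.card + 1 : ℕ) ≤ M) (hT : ∀ v ∈ T, c.fast v = none)
    (hTs : ∀ v ∈ T, c.slow v = some (parents E v)) :
    Run E M c (c.complete E T) T.card := by
  rw [← Config.loaded_eq_complete (by simpa using hTs)]
  refine Run.loaded_card T hT (le_trans ?_ hM)
  refine (Set.encard_union_le _ _).trans ?_
  rw [Set.encard_coe_eq_coe_finsetCard]
  gcongr
  omega

end Pebble

theorem exists_finset_cover (α : Type*) [Fintype α] {a : ℕ} (ha : 0 < a) :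
    ∃ P : Finset (Finset α), (∀ x, ∃ A ∈ P, x ∈ A) ∧ (∀ A ∈ P, A.card ≤ a) ∧
      P.card ≤ Fintype.card α / a + 1 := by
  classical
  let e := Fintype.equivFin α
  let B (p : ℕ) : Finset α := {x | (e x : ℕ) / a = p}
  refine ⟨(Finset.range (Fintype.card α / a + 1)).image B, fun x => ?_, fun A hA => ?_,
    Finset.card_image_le.trans (by simp)⟩
  · refine ⟨B (e x / a), Finset.mem_image_of_mem _ ?_, by simp [B]⟩
    rw [Finset.mem_range, Nat.lt_succ_iff]
    exact Nat.div_le_div_right (e x).2.le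
  · obtain ⟨p, -, rfl⟩ := Finset.mem_image.1 hA
    have : (Finset.Ico (p * a) (p * a + a)).card = a := by simp
    rw [← this]
    refine Finset.card_le_card_of_injOn (fun x => e x) (fun x hx => ?_) (fun x _ y _ h => ?_)
    · simp only [B, Finset.coe_filter, Set.mem_ofPred_eq, Finset.mem_univ, true_and] at hx
      simp only [Finset.coe_Ico, Set.mem_Ico]
      rw [← hx]
      exact ⟨Nat.div_mul_le_self _ _, Nat.lt_div_mul_add ha⟩
    · exact e.injective (Fin.ext h)

namespace ApproxAttention

open Pebble

variable {n d g M : ℕ}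

theorem Monomial.eq_of_forall_eq_zero {m m' : Monomial d g} (h : ∀ l, m.1 l = 0)
    (h' : ∀ l, m'.1 l = 0) : m = m' :=
  Subtype.ext (funext fun l => (h l).trans (h' l).symm)

theorem eq_zero_of_isSource_u₁ {i : Fin n} {m : Monomial d g}
    (h : IsSource Edge (.u₁ i m : Node n d g)) (l : Fin d) : m.1 l = 0 := by
  by_contra h'
  exact h _ (.q_u₁ i l m h')

theorem eq_zero_of_isSource_u₂ {i : Fin n} {m : Monomial d g}
    (h : IsSource Edge (.u₂ i m : Node n d g)) (l : Fin d) : m.1 l = 0 := by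
  by_contra h'
  exact h _ (.k_u₂ i l m h')

theorem keyBlock_eq [DecidableEq (Node n d g)] (i : Fin n) (A : Finset (Monomial d g)) :
    keyBlock i A = ((A.image (.u₂ i) : Finset (Node n d g)) : Set (Node n d g)) := by
  ext x
  simp [keyBlock, eq_comm]

theorem queryBlock_eq [DecidableEq (Node n d g)] (i : Fin n) (A : Finset (Monomial d g)) :
    queryBlock i A = ((A.image (.u₁ i) : Finset (Node n d g)) : Set (Node n d g)) := by
  ext x
  simp [queryBlock, eq_comm]

theorem encard_add_card_image_le {α V : Type*} [DecidableEq V] {F : Set V} {a : ℕ} {A : Finset α}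
    (hA : A.card ≤ a) (hM : F.encard + (a + 2 : ℕ) ≤ M) (f : α → V) :
    F.encard + ((A.image f).card + 1 : ℕ) ≤ M := by
  refine le_trans ?_ hM
  gcongr
  · exact Finset.card_image_le.trans hA
  · exact one_le_two

/-- The cost if the entries of `U₁` and `U₂` are computed whenever they are used. -/
theorem ioCost_le_of_small_dim {a : ℕ} (hn : 0 < n) (hd : 0 < d) (hg : 0 < g) (ha : 0 < a)
    (hM : a * (d + 1) + a + 2 ≤ M) :
    ioCost n d g M ≤ ((rank d g / a + 1) * (n * (5 * (d + 1))) + n * d * 4 : ℕ) := by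
  classical
  obtain ⟨P, hP, hPa, hPc⟩ := exists_finset_cover (Monomial d g) ha
  rw [card_monomial] at hPc
  -- The `d` loads in `κ` are for a row of `K` or `Q`; the additional one is for the constant
  -- monomial, whose entry is a source and can only be loaded.
  have h := run_blocks (S := ∅) (M := M) (κ := 1 + d) (a := a) (b := d + 1) hn P {Finset.univ} hP
    (by simp) hPa (by simp) hM ?_
  · refine (ioCost_le_of_run (by omega) hn hd hg Set.subset_union_right h).trans ?_
    rw [Finset.card_singleton, mul_one]
    norm_cast
    refine Nat.add_le_add_right (Nat.mul_le_mul hPc (Nat.mul_le_mul_left _ (by omega))) _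
  intro A hA i c hslow hfast hcap
  have hcard : ∀ f : Fin d → Node n d g, (Finset.univ.image f).card ≤ d :=
    fun f => Finset.card_image_le.trans (by simp)
  constructor
  · rw [keyBlock_eq]
    refine (Run.complete_block (S := ∅) (k := 1) (A.image (.u₂ i)) (Finset.univ.image (.k i))
      (encard_add_card_image_le (hPa A hA) hcap _) ?_ ?_ ?_ ?_ ?_ ?_ ?_).mono
      (Nat.add_le_add_left (hcard _) 1)
    · simpa using fun m _ => hfast (.u₂ i m) (by simp)
    · simpa using fun m _ => hslow (.u₂ i m) (by simp [outNodes])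
    · intro v hv u hu
      obtain ⟨m, -, rfl⟩ := Finset.mem_image.1 hv
      cases hu
      simp
    · simp
    · simpa using fun l => hfast (.k i l) (by simp)
    · intro u hu
      obtain ⟨l, -, rfl⟩ := Finset.mem_image.1 hu
      rw [hslow _ (by simp [outNodes]), slow_stored (.inr (isSource_k i l))]
    · rw [Nat.cast_one, Set.encard_le_one_iff]
      rintro x y ⟨hx, hx'⟩ ⟨hy, hy'⟩
      obtain ⟨m, -, rfl⟩ := Finset.mem_image.1 hx
      obtain ⟨m', -, rfl⟩ := Finset.mem_image.1 hy
      rw [Monomial.eq_of_forall_eq_zero (eq_zero_of_isSource_u₂ (hx'.resolve_left id))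
        (eq_zero_of_isSource_u₂ (hy'.resolve_left id))]
  · rw [queryBlock_eq]
    refine (Run.complete_block (S := ∅) (k := 1) (A.image (.u₁ i)) (Finset.univ.image (.q i))
      (encard_add_card_image_le (hPa A hA) hcap _) ?_ ?_ ?_ ?_ ?_ ?_ ?_).mono
      (Nat.add_le_add_left (hcard _) 1)
    · simpa using fun m _ => hfast (.u₁ i m) (by simp)
    · simpa using fun m _ => hslow (.u₁ i m) (by simp [outNodes])
    · intro v hv u hu
      obtain ⟨m, -, rfl⟩ := Finset.mem_image.1 hv
      cases hu
      simp
    · simp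
    · simpa using fun l => hfast (.q i l) (by simp)
    · intro u hu
      obtain ⟨l, -, rfl⟩ := Finset.mem_image.1 hu
      rw [hslow _ (by simp [outNodes]), slow_stored (.inr (isSource_q i l))]
    · rw [Nat.cast_one, Set.encard_le_one_iff]
      rintro x y ⟨hx, hx'⟩ ⟨hy, hy'⟩
      obtain ⟨m, -, rfl⟩ := Finset.mem_image.1 hx
      obtain ⟨m', -, rfl⟩ := Finset.mem_image.1 hy
      rw [Monomial.eq_of_forall_eq_zero (eq_zero_of_isSource_u₁ (hx'.resolve_left id))
        (eq_zero_of_isSource_u₁ (hy'.resolve_left id))]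

open Classical in
/-- The computation of `U₁` and `U₂` in blocks. -/
theorem run_factors {a : ℕ} (P : Finset (Finset (Monomial d g))) (hP : ∀ m, ∃ A ∈ P, m ∈ A)
    (hPa : ∀ A ∈ P, A.card ≤ a) (hM : a + 1 ≤ M) :
    Run Edge M (stored Edge ∅) (stored Edge (factorNodes n d g))
      (2 * (n * P.card * (2 * a + d))) := by
  let S₁ : Set (Node n d g) := {x | ∃ i m, x = .u₁ i m}
  have hcard : ∀ f : Fin d → Node n d g, (Finset.univ.image f).card ≤ d :=
    fun f => Finset.card_image_le.trans (by simp)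
  have hmem : ∀ x ∈ (Finset.univ : Finset (Fin n)) ×ˢ P, x.2 ∈ P :=
    fun x hx => (Finset.mem_product.1 hx).2
  have h₁ : Run Edge M (stored Edge ∅) (stored Edge S₁) (n * P.card * (2 * a + d)) := by
    have h := Run.store (M := M) (E := Edge) (S := ∅) (S' := S₁)
      ((Finset.univ : Finset (Fin n)) ×ˢ P) (fun x => x.2.image (.u₁ x.1))
      (fun x => Finset.univ.image (.q x.1)) (t := a) (e := d) ?_ hM
      (fun x hx => Finset.card_image_le.trans (hPa _ (hmem x hx))) (fun _ _ => hcard _)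
      (fun x _ v hv u hu => by
        obtain ⟨m, -, rfl⟩ := Finset.mem_image.1 hv
        cases hu
        simp)
      (fun x _ u hu => by
        obtain ⟨l, -, rfl⟩ := Finset.mem_image.1 hu
        exact .inr (isSource_q _ l))
      (fun x _ u hu => by
        obtain ⟨l, -, rfl⟩ := Finset.mem_image.1 hu
        simp)
    · simpa [Finset.card_product] using h
    · ext x
      simp only [S₁, Set.mem_ofPred_eq, Set.empty_union, Set.mem_iUnion, Finset.coe_image,
        Set.mem_image, Finset.mem_coe, exists_prop, Prod.exists, Finset.mem_product,
        Finset.mem_univ, true_and]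
      constructor
      · rintro ⟨i, m, rfl⟩
        obtain ⟨A, hA, hm⟩ := hP m
        exact ⟨i, A, hA, m, hm, rfl⟩
      · rintro ⟨i, A, -, m, -, rfl⟩
        exact ⟨i, m, rfl⟩
  have h₂ : Run Edge M (stored Edge S₁) (stored Edge (factorNodes n d g))
      (n * P.card * (2 * a + d)) := by
    have h := Run.store (M := M) (E := Edge) (S := S₁) (S' := factorNodes n d g)
      ((Finset.univ : Finset (Fin n)) ×ˢ P) (fun x => x.2.image (.u₂ x.1))
      (fun x => Finset.univ.image (.k x.1)) (t := a) (e := d) ?_ hM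
      (fun x hx => Finset.card_image_le.trans (hPa _ (hmem x hx))) (fun _ _ => hcard _)
      (fun x _ v hv u hu => by
        obtain ⟨m, -, rfl⟩ := Finset.mem_image.1 hv
        cases hu
        simp)
      (fun x _ u hu => by
        obtain ⟨l, -, rfl⟩ := Finset.mem_image.1 hu
        exact .inr (isSource_k _ l))
      (fun x _ u hu => by
        obtain ⟨l, -, rfl⟩ := Finset.mem_image.1 hu
        simp)
    · simpa [Finset.card_product] using h
    · ext x
      simp only [S₁, factorNodes, Set.mem_ofPred_eq, Set.mem_union, Set.mem_iUnion,
        Finset.coe_image, Set.mem_image, Finset.mem_coe, exists_prop, Prod.exists,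
        Finset.mem_product, Finset.mem_univ, true_and]
      constructor
      · rintro ⟨i, m, rfl | rfl⟩
        · exact .inl ⟨i, m, rfl⟩
        · obtain ⟨A, hA, hm⟩ := hP m
          exact .inr ⟨i, A, hA, m, hm, rfl⟩
      · rintro (⟨i, m, rfl⟩ | ⟨i, A, -, m, -, rfl⟩)
        · exact ⟨i, m, .inl rfl⟩
        · exact ⟨i, m, .inr rfl⟩
  exact (h₁.trans h₂).mono (by omega)

/-- The cost if the entries of `U₁` and `U₂` are computed only once. -/
theorem ioCost_le_of_large_dim {a : ℕ} (hn : 0 < n) (hd : 0 < d) (hg : 0 < g) (ha : 0 < a)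
    (hM : a * a + a + 2 ≤ M) :
    ioCost n d g M ≤ (2 * (n * (rank d g / a + 1) * (2 * a + d)) +
      (rank d g / a + 1) * ((d + 1) / a + 1) * (n * (5 * a)) + n * d * 4 : ℕ) := by
  classical
  obtain ⟨P, hP, hPa, hPc⟩ := exists_finset_cover (Monomial d g) ha
  obtain ⟨R, hR, hRa, hRc⟩ := exists_finset_cover (Option (Fin d)) ha
  rw [card_monomial] at hPc
  rw [Fintype.card_option, Fintype.card_fin] at hRc
  have h₁ := run_factors (n := n) (M := M) P hP hPa (by omega)
  have h₂ := run_blocks (S := factorNodes n d g) (M := M) (κ := a) hn P R hP hR hPa hRa hM ?_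
  · refine (ioCost_le_of_run (by omega) hn hd hg Set.subset_union_right (h₁.trans h₂)).trans ?_
    have h5 : 2 * a + 3 * a = 5 * a := by ring
    rw [h5]
    norm_cast
    gcongr
  intro A hA i c hslow hfast hcap
  constructor
  · rw [keyBlock_eq]
    refine (Run.load_block _ (encard_add_card_image_le (hPa A hA) hcap _) ?_ ?_).mono
      (Finset.card_image_le.trans (hPa A hA))
    · simpa using fun m _ => hfast (.u₂ i m) (by simp)
    · intro u hu
      obtain ⟨m, -, rfl⟩ := Finset.mem_image.1 hu
      rw [hslow _ (by simp [outNodes]), slow_stored (.inl (show _ ∈ factorNodes n d g from ⟨i, m, .inr rfl⟩))]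
  · rw [queryBlock_eq]
    refine (Run.load_block _ (encard_add_card_image_le (hPa A hA) hcap _) ?_ ?_).mono
      (Finset.card_image_le.trans (hPa A hA))
    · simpa using fun m _ => hfast (.u₁ i m) (by simp)
    · intro u hu
      obtain ⟨m, -, rfl⟩ := Finset.mem_image.1 hu
      rw [hslow _ (by simp [outNodes]), slow_stored (.inl (show _ ∈ factorNodes n d g from ⟨i, m, .inl rfl⟩))]

theorem lt_rank_of_pos (hd : 0 < d) : g < rank d g := by
  rw [rank, ← Nat.choose_symm_add]
  calc g < (g + 1).choose 1 := by simp
    _ ≤ (g + d).choose d := by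
      obtain ⟨e, rfl⟩ : ∃ e, d = e + 1 := ⟨d - 1, by omega⟩
      rw [Nat.choose_one_right]
      clear hd
      induction e with
      | zero => simp
      | succ e ih =>
        refine ih.trans ?_
        rw [show g + (e + 1 + 1) = (g + (e + 1)) + 1 by ring, Nat.choose_succ_succ]
        exact Nat.le_add_right _ _
    _ = (d + g).choose d := by rw [add_comm]

theorem rank_comm (d g : ℕ) : rank d g = rank g d := by
  rw [rank, rank, add_comm g d, ← Nat.choose_symm_add]

theorem dim_lt_rank (hg : 0 < g) : d < rank d g := rank_comm d g ▸ lt_rank_of_pos hg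

/-- For `a ≤ d`, storing `U₁` and `U₂` costs `O(n r d / a)`, which is affordable. For `d < a`,
storing would cost order `n r`, which is too much; instead all `d + 1 ≤ a` columns fit into one tile
and the blocks are recomputed. The rounding in `r / a + 1` is harmless since `a = O(r)`: by `a ≤ d <
r` in the first case, by `hC` in the second. -/
theorem exists_ioCost_le {a C : ℕ} (hn : 0 < n) (hd : 0 < d) (hg : 0 < g) (ha : 0 < a)
    (hM : a * a + a + 2 ≤ M) (hC : a ≤ C * rank d g) :
    ∃ k : ℕ, ioCost n d g M ≤ k ∧ a * k ≤ (46 + 14 * C) * (n * rank d g * d) := by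
  have hdr : d < rank d g := dim_lt_rank hg
  set r := rank d g
  have hp : a * (r / a + 1) ≤ r + a := by
    rw [mul_add, mul_one]
    exact Nat.add_le_add_right (Nat.mul_div_le r a) a
  have hq : a * ((d + 1) / a + 1) ≤ d + 1 + a := by
    rw [mul_add, mul_one]
    exact Nat.add_le_add_right (Nat.mul_div_le (d + 1) a) a
  set p := r / a + 1
  set q := (d + 1) / a + 1
  by_cases had : a ≤ d
  · have hp' : a * p ≤ 2 * r := by omega
    have hq' : a * q ≤ 3 * d := by omega
    have had' : 2 * a + d ≤ 3 * d := by omega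
    have har : a ≤ r := by omega
    refine ⟨_, ioCost_le_of_large_dim hn hd hg ha hM, ?_⟩
    calc a * (2 * (n * p * (2 * a + d)) + p * q * (n * (5 * a)) + n * d * 4)
        = 2 * (n * (a * p) * (2 * a + d)) + (a * p) * (a * q) * (n * 5) + n * d * 4 * a := by ring
      _ ≤ 2 * (n * (2 * r) * (3 * d)) + (2 * r) * (3 * d) * (n * 5) + n * d * 4 * r := by
        gcongr
      _ = 46 * (n * r * d) := by ring
      _ ≤ (46 + 14 * C) * (n * r * d) := by gcongr; omega
  · have hM' : a * (d + 1) + a + 2 ≤ M :=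
      le_trans (by gcongr; omega) hM
    have hp' : a * p ≤ r + C * r := by omega
    have hd' : d + 1 ≤ 2 * d := by omega
    refine ⟨_, ioCost_le_of_small_dim hn hd hg ha hM', ?_⟩
    calc a * (p * (n * (5 * (d + 1))) + n * d * 4)
        = (a * p) * (n * (5 * (d + 1))) + n * d * 4 * a := by ring
      _ ≤ (r + C * r) * (n * (5 * (2 * d))) + n * d * 4 * (C * r) := by
        gcongr
      _ = (10 + 14 * C) * (n * r * d) := by ring
      _ ≤ (46 + 14 * C) * (n * r * d) := by gcongr; omega

end ApproxAttention

/-! ### Choice of the parameters and asymptotics -/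

namespace ApproxAttention

open Pebble

variable {n d g M : ℕ}

/-- For `M ≥ 16` the tile side is half of the integer square root, rounded down: the tile, a block
and two spare cells fit, and `√M ≤ 4 a`. For `M < 16` the factor `√M ≤ 4` is absorbed by the
constant, so the naive strategy suffices. -/
theorem ioCost_le_ofReal {C : ℕ} (hM : 2 ≤ M) (hn : 0 < n) (hd : 0 < d)
    (hC : √(M : ℝ) ≤ C * g) :
    (ioCost n d g M : ℝ≥0∞) ≤
      ENNReal.ofReal (4 * (46 + 14 * C) * ((n : ℝ) * (rank d g : ℝ) * (d : ℝ) / √(M : ℝ))) := by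
  have hM0 : (0 : ℝ) < √(M : ℝ) := Real.sqrt_pos.2 (by exact_mod_cast (by omega : 0 < M))
  have hg : 0 < g := by
    rcases Nat.eq_zero_or_pos g with rfl | h
    · simp only [Nat.cast_zero, mul_zero] at hC
      exact absurd hC (not_le.2 hM0)
    · exact h
  suffices ∃ k : ℕ, ioCost n d g M ≤ k ∧
      (k : ℝ) * √(M : ℝ) ≤ 4 * (46 + 14 * C) * ((n : ℝ) * (rank d g : ℝ) * (d : ℝ)) by
    obtain ⟨k, hk, hkM⟩ := this
    have h1 : (ioCost n d g M : ℝ≥0∞) ≤ ((k : ℕ∞) : ℝ≥0∞) := by exact_mod_cast hk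
    refine h1.trans ?_
    rw [ENat.toENNReal_coe, ← ENNReal.ofReal_natCast]
    refine ENNReal.ofReal_le_ofReal ?_
    rw [mul_div_assoc', le_div_iff₀ hM0]
    exact hkM
  rcases lt_or_ge M 16 with hM16 | hM16
  · refine ⟨_, ioCost_le_naive hM hn hd hg, ?_⟩
    have h4 : √(M : ℝ) ≤ 4 := by
      rw [Real.sqrt_le_left (by norm_num)]
      exact_mod_cast (by omega : M ≤ 4 ^ 2)
    push_cast
    have hx : (0 : ℝ) ≤ (n : ℝ) * (rank d g : ℝ) * (d : ℝ) := by positivity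
    have hCx : (0 : ℝ) ≤ C * ((n : ℝ) * (rank d g : ℝ) * (d : ℝ)) := by positivity
    nlinarith
  · have hs1 := Nat.sqrt_le M
    have hs2 := Nat.sqrt_lt_self (by omega : 1 < M)
    have hs4 : 4 ≤ Nat.sqrt M := Nat.le_sqrt.2 (by omega)
    have hs3 := Nat.lt_succ_sqrt M
    set s := Nat.sqrt M
    have ha2 : 2 * (s / 2) ≤ s := Nat.mul_div_le s 2
    have ha4 : s + 1 ≤ 4 * (s / 2) := by omega
    set a := s / 2
    have hsM : (s : ℝ) ≤ √(M : ℝ) := Real.nat_sqrt_le_real_sqrt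
    have hMs : √(M : ℝ) ≤ s + 1 := Real.real_sqrt_le_nat_sqrt_succ
    have haC : a ≤ C * rank d g := by
      have h1 : (a : ℝ) ≤ C * g := by
        refine le_trans ?_ (hsM.trans hC)
        exact_mod_cast (by omega : a ≤ s)
      have h2 : a ≤ C * g := by exact_mod_cast h1
      exact h2.trans (Nat.mul_le_mul_left _ (lt_rank_of_pos hd).le)
    have haM : a * a + a + 2 ≤ M := by nlinarith
    obtain ⟨k, hk, hak⟩ := exists_ioCost_le hn hd hg (by omega) haM haC
    refine ⟨k, hk, ?_⟩
    have hak' : (a : ℝ) * k ≤ (46 + 14 * C) * ((n : ℝ) * (rank d g : ℝ) * (d : ℝ)) := by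
      exact_mod_cast hak
    have h4 : √(M : ℝ) ≤ 4 * a := hMs.trans (by exact_mod_cast ha4)
    calc (k : ℝ) * √(M : ℝ) ≤ k * (4 * a) := by gcongr
      _ = 4 * (a * k) := by ring
      _ ≤ 4 * ((46 + 14 * C) * ((n : ℝ) * (rank d g : ℝ) * (d : ℝ))) := by gcongr
      _ = _ := by ring

/-- For `s` of order `√M`, all three terms of the edge bound per segment are `O(M * √M)`. -/
theorem le_of_reach {C k : ℕ} (hM : 0 < M) (hC0 : 0 < C) (hC : √(M : ℝ) ≤ C * g) (hgd : g ≤ d)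
    (hMn : 4 * M ≤ n) {c : Config (Node n d g)} (h : Reach Edge M c k) (hc : IsFinal Edge c) :
    1 / (24 + 64 * C) * ((n : ℝ) * (rank d g : ℝ) * (d : ℝ) / √(M : ℝ)) ≤ k := by
  have hM1 : (1 : ℝ) ≤ √(M : ℝ) := Real.one_le_sqrt.2 (by exact_mod_cast hM)
  have hsq : √(M : ℝ) * √(M : ℝ) = M := Real.mul_self_sqrt (Nat.cast_nonneg M)
  set x := √(M : ℝ)
  have hx0 : 0 < x := by linarith
  have hC1 : (1 : ℝ) ≤ C := by exact_mod_cast hC0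
  -- As `x ≤ C * g`, this is below `g / 4 + 1`, which is exactly what `4 * s ≤ g + 3` needs;
  -- rounding up keeps `s` positive.
  let s := ⌈x / (4 * C)⌉₊
  have hs0 : 0 < s := Nat.ceil_pos.2 (by positivity)
  have hs_lt : (s : ℝ) < x / (4 * C) + 1 := Nat.ceil_lt_add_one (by positivity)
  have hs_ge : x / (4 * C) ≤ s := Nat.le_ceil _
  have hsx : (s : ℝ) ≤ 2 * x := by
    have : x / (4 * C) ≤ x := div_le_self hx0.le (by linarith)
    linarith
  have hsg : 4 * s ≤ g + 3 := by
    have h1 : x / (4 * C) ≤ g / 4 := by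
      rw [div_le_div_iff₀ (by positivity) (by norm_num)]
      nlinarith
    have h2 : (4 * s : ℝ) < g + 4 := by linarith
    have h3 : 4 * s < g + 4 := by exact_mod_cast h2
    omega
  have hw := rank_le_two_mul_wideCard hs0 hsg hgd
  have hl := lower_bound_of_reach hM hs0 h hc
  set w := wideCard d g s
  have hdiv : ((2 * M / s : ℕ) : ℝ) ≤ 8 * C * x := by
    refine Nat.cast_div_le.trans ?_
    rw [div_le_iff₀ (by exact_mod_cast hs0)]
    rw [div_le_iff₀ (by positivity)] at hs_ge
    push_cast
    nlinarith
  have hB : ((2 * M + 2 * M * s + 2 * M / s * (2 * M) : ℕ) : ℝ) ≤ (6 + 16 * C) * (M * x) := by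
    have hM0 : (0 : ℝ) ≤ M := Nat.cast_nonneg M
    calc ((2 * M + 2 * M * s + 2 * M / s * (2 * M) : ℕ) : ℝ)
        = 2 * M * 1 + 2 * M * s + ((2 * M / s : ℕ) : ℝ) * (2 * M) := by push_cast; ring
      _ ≤ 2 * M * x + 2 * M * (2 * x) + 8 * C * x * (2 * M) := by gcongr
      _ = _ := by ring
  have hnM : (n : ℝ) ≤ 2 * ((n - 2 * M : ℕ) : ℝ) := by
    exact_mod_cast (by omega : n ≤ 2 * (n - 2 * M))
  have hl' : (M : ℝ) * (w * d * ((n - 2 * M : ℕ) : ℝ)) ≤ k * ((6 + 16 * C) * (M * x)) := by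
    refine le_trans ?_ (mul_le_mul_of_nonneg_left hB (Nat.cast_nonneg k))
    exact_mod_cast hl
  have hw' : (rank d g : ℝ) ≤ 2 * w := by exact_mod_cast hw
  have hMpos : (0 : ℝ) < M := by exact_mod_cast hM
  have key : (n : ℝ) * (rank d g : ℝ) * d ≤ (24 + 64 * C) * (k * x) := by
    have h1 : (w : ℝ) * d * ((n - 2 * M : ℕ) : ℝ) ≤ k * ((6 + 16 * C) * x) := by
      refine le_of_mul_le_mul_left (hl'.trans_eq ?_) hMpos
      ring
    -- One factor `2` pays for the `2 * M` unrecorded rows, the other for the monomials with fewer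
    -- than `s` variables.
    calc (n : ℝ) * (rank d g : ℝ) * d ≤ (2 * ((n - 2 * M : ℕ) : ℝ)) * (2 * w) * d := by gcongr
      _ = 4 * (w * d * ((n - 2 * M : ℕ) : ℝ)) := by ring
      _ ≤ 4 * (k * ((6 + 16 * C) * x)) := by gcongr
      _ = _ := by ring
  rw [one_div_mul_eq_div, div_div, div_le_iff₀ (by positivity)]
  linarith

theorem ofReal_le_ioCost {C : ℕ} (hM : 0 < M) (hC0 : 0 < C) (hC : √(M : ℝ) ≤ C * g)
    (hgd : g ≤ d) (hMn : 4 * M ≤ n) :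
    ENNReal.ofReal (1 / (24 + 64 * C) * ((n : ℝ) * (rank d g : ℝ) * (d : ℝ) / √(M : ℝ))) ≤
      (ioCost n d g M : ℝ≥0∞) := by
  set Q := {q : ℕ∞ | ∃ (c : Config (Node n d g)) (k : ℕ),
    Reach Edge M c k ∧ IsFinal Edge c ∧ q = k} with hQ
  have hio : ioCost n d g M = sInf Q := rfl
  rcases Q.eq_empty_or_nonempty with h | h
  · simp [hio, h]
  · obtain ⟨c, k, hr, hf, hk⟩ := csInf_mem h
    rw [hio, hk, ENat.toENNReal_coe, ← ENNReal.ofReal_natCast]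
    exact ENNReal.ofReal_le_ofReal (le_of_reach hM hC0 hC hgd hMn hr hf)

/-- Already `(d + 3).choose 3 ≥ (d + 1) ^ 3 / 6 ≥ 125 * g ^ 3 / 6`. -/
theorem twenty_mul_pow_le_rank (hg : 3 ≤ g) (hgd : 5 * g ≤ d) : 20 * g ^ 3 ≤ rank d g := by
  have h1 : (d + 3).choose 3 ≤ rank d g := by
    rw [← Nat.choose_symm_add, rank_comm, rank, add_comm g d]
    exact Nat.choose_le_choose d (by omega)
  have h2 : ((d + 3 + 1 - 3 : ℕ) ^ 3 : ℕ) ≤ Nat.factorial 3 * (d + 3).choose 3 := by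
    rw [← Nat.descFactorial_eq_factorial_mul_choose]
    exact Nat.pow_sub_le_descFactorial (d + 3) 3
  have h3 : (5 * g) ^ 3 ≤ (d + 3 + 1 - 3) ^ 3 := Nat.pow_le_pow_left (by omega) 3
  have h4 : Nat.factorial 3 = 6 := rfl
  rw [h4] at h2
  have h5 : (5 * g) ^ 3 = 125 * g ^ 3 := by ring
  omega

/-- Since `M ≤ (C * g) ^ 2` is quadratic in `g` and the rank is at least cubic, the claim holds once
`g > C ^ 2 + 3`. For smaller `g` the capacity is bounded, and `hr` asks the rank to exceed that
bound. -/
theorem four_mul_le_rank {C : ℕ} (hC : √(M : ℝ) ≤ C * g) (hgd : 5 * g ≤ d)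
    (hr : 4 * (C * (C ^ 2 + 3)) ^ 2 ≤ rank d g) : 4 * M ≤ rank d g := by
  have hM : M ≤ (C * g) ^ 2 := by
    have : (M : ℝ) ≤ (C * g) ^ 2 := (Real.sqrt_le_left (by positivity)).1 hC
    exact_mod_cast this
  rcases le_or_gt g (C ^ 2 + 3) with h | h
  · refine le_trans ?_ hr
    refine (Nat.mul_le_mul_left 4 hM).trans ?_
    gcongr
  · calc 4 * M ≤ 4 * (C * g) ^ 2 := Nat.mul_le_mul_left 4 hM
      _ = 4 * (C ^ 2 * g ^ 2) := by ring
      _ ≤ 4 * (g * g ^ 2) := by gcongr; omega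
      _ = 4 * g ^ 3 := by ring
      _ ≤ 20 * g ^ 3 := by omega
      _ ≤ rank d g := twenty_mul_pow_le_rank (by omega) hgd

/-- If the capacity is at least `2` and of smaller order than `d * r`, then `r` is unbounded. -/
theorem le_rank_of_le {R : ℕ} (hM : 2 ≤ M) (hg : 0 < g)
    (h : (M : ℝ) ≤ 1 / ((R : ℝ) ^ 2 + 1) * ((d : ℝ) * (rank d g : ℝ))) : R ≤ rank d g := by
  by_contra! hlt
  have hdr : d < rank d g := dim_lt_rank hg
  rw [one_div_mul_eq_div, le_div_iff₀ (by positivity)] at h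
  -- As `d < r < R`, this would force `M ≤ R ^ 2 / (R ^ 2 + 1) < 1`.
  have h1 : (d : ℝ) * (rank d g : ℝ) ≤ R * R := by
    gcongr
    exact_mod_cast (hdr.trans hlt).le
  have h2 : (2 : ℝ) ≤ M := by exact_mod_cast hM
  nlinarith [sq_nonneg (R : ℝ)]

end ApproxAttention

theorem theorem4 {ι : Type*} (l : Filter ι) (n d g M : ι → ℕ)
    (hM2 : ∀ᶠ t in l, 2 ≤ M t)
    (hrn : ∀ᶠ t in l, ApproxAttention.rank (d t) (g t) ≤ n t)
    (hM : (fun t => (M t : ℝ)) =o[l]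
      fun t => (d t : ℝ) * (ApproxAttention.rank (d t) (g t) : ℝ))
    (hg : (fun t => √(M t : ℝ)) =O[l] fun t => (g t : ℝ)) :
    (∃ C : ℝ, 0 < C ∧ ∀ᶠ t in l,
      (ApproxAttention.ioCost (n t) (d t) (g t) (M t) : ℝ≥0∞) ≤
        ENNReal.ofReal (C * ((n t : ℝ) * (ApproxAttention.rank (d t) (g t) : ℝ) * (d t : ℝ)
          / √(M t : ℝ)))) ∧
    ((∀ᶠ t in l, 5 * g t ≤ d t) →
      ∃ c : ℝ, 0 < c ∧ ∀ᶠ t in l,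
        ENNReal.ofReal (c * ((n t : ℝ) * (ApproxAttention.rank (d t) (g t) : ℝ) * (d t : ℝ)
          / √(M t : ℝ))) ≤
          (ApproxAttention.ioCost (n t) (d t) (g t) (M t) : ℝ≥0∞)) := by
  obtain ⟨C, hC0, hC⟩ : ∃ C : ℕ, 0 < C ∧ ∀ᶠ t in l, √(M t : ℝ) ≤ C * g t := by
    obtain ⟨c, hc⟩ := hg.bound
    refine ⟨⌈c⌉₊ + 1, Nat.succ_pos _, hc.mono fun t ht => ?_⟩
    rw [Real.norm_of_nonneg (Real.sqrt_nonneg _), Real.norm_natCast] at ht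
    refine ht.trans ?_
    gcongr
    push_cast
    linarith [Nat.le_ceil c]
  have hMd : ∀ ε : ℝ, 0 < ε → ∀ᶠ t in l,
      (M t : ℝ) ≤ ε * ((d t : ℝ) * (ApproxAttention.rank (d t) (g t) : ℝ)) := by
    intro ε hε
    filter_upwards [hM.def hε] with t ht
    rwa [Real.norm_natCast, Real.norm_of_nonneg (by positivity)] at ht
  have hn : ∀ᶠ t in l, 0 < n t := by
    filter_upwards [hrn] with t ht
    exact (Nat.choose_pos (Nat.le_add_left _ _)).trans_le ht
  refine ⟨⟨4 * (46 + 14 * C), by positivity, ?_⟩,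
    fun hgd => ⟨1 / (24 + 64 * C), by positivity, ?_⟩⟩
  -- For the upper bound, `M = o(d r)` only serves to exclude `d = 0`.
  · filter_upwards [hM2, hn, hC, hMd 1 one_pos] with t h2 hn hC hd
    refine ApproxAttention.ioCost_le_ofReal h2 hn (Nat.pos_of_ne_zero fun h0 => ?_) hC
    have : (2 : ℝ) ≤ M t := by exact_mod_cast h2
    rw [h0] at hd
    norm_num at hd
    omega
  -- For the lower bound, `M = o(d r)` makes the rank exceed this threshold, so that `4 M ≤ r ≤ n`.
  · set R := 4 * (C * (C ^ 2 + 3)) ^ 2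
    filter_upwards [hM2, hrn, hC, hgd, hMd (1 / ((R : ℝ) ^ 2 + 1)) (by positivity)]
      with t h2 hrn hC hgd hd
    have hM0 : 0 < M t := by omega
    have hg0 : 0 < g t := by
      refine Nat.pos_of_ne_zero fun h0 => ?_
      have : 0 < √(M t : ℝ) := Real.sqrt_pos.2 (by exact_mod_cast hM0)
      rw [h0] at hC
      simp only [Nat.cast_zero, mul_zero] at hC
      linarith
    refine ApproxAttention.ofReal_le_ioCost hM0 hC0 hC (by omega) (le_trans ?_ hrn)
    exact ApproxAttention.four_mul_le_rank hC hgd (ApproxAttention.le_rank_of_le h2 hg0 hd)
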